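/- Let $a<b$ be real numbers and let $f:(a,b)\to\mathbb R$ be locally integrable. For an open interval $I=(c,d)$ with $a<c<d<b$ let $(f)_I=\frac1{|I|}\int_I f\,dx$ and $\operatorname{osc}(f,I)=\frac1{|I|}\int_I|f-(f)_I|\,dx$. For open $U\subseteq(a,b)$ let $$|Df|(U)=\sup\Big\{\int_U f\varphi'\,dx:\ \varphi\in C_c^\infty(U),\ |\varphi|\le 1\Big\}\in[0,\infty],$$ and for Borel $B\subseteq(a,b)$ let $|Df|(B)=\inf\{|Df|(U): B\subseteq U\subseteq(a,b),\ U\text{ open}\}$. Suppose that there is a positive Borel measure $\mu$ on $(a,b)$ such that $\mu(I)=\operatorname{osc}(f,I)$ for every open interval $I=(c,d)$ with $a<c<d<b$. Then $\mu=\frac14|Df|$ on all Borel subsets of $(a,b)$, and $f$ is affine, i.e. there are $p,q\in\mathbb R$ with $f(x)=px+q$ for almost every $x\in(a,b)$. -/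

import Mathlib

open MeasureTheory Set
open scoped ENNReal ContDiff

noncomputable section

/-- The mean value `(f)_I` of `f` over `I = (c, d)`. -/
def meanValue (f : ℝ → ℝ) (c d : ℝ) : ℝ :=
  (d - c)⁻¹ * ∫ x in Ioo c d, f x

/-- The mean oscillation `osc(f, I)` of `f` on `I = (c, d)`. -/
def osc (f : ℝ → ℝ) (c d : ℝ) : ℝ :=
  (d - c)⁻¹ * ∫ x in Ioo c d, |f x - meanValue f c d|

/-- The total variation `|Df|(U) ∈ [0, ∞]` of the distributional derivative of `f` on an open
set `U`: the supremum of `∫_U f φ'` over `φ ∈ C_c^∞(U)` with `|φ| ≤ 1`. (The supremum is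
nonnegative because `φ = 0` is admissible, so truncating negative values does not change it.) -/
def openVariation (f : ℝ → ℝ) (U : Set ℝ) : ℝ≥0∞ :=
  ⨆ (φ : ℝ → ℝ) (_ : ContDiff ℝ ∞ φ) (_ : HasCompactSupport φ) (_ : tsupport φ ⊆ U)
    (_ : ∀ x, |φ x| ≤ 1), ENNReal.ofReal (∫ x in U, f x * deriv φ x)

/-- The total variation `|Df|(B)` of a set `B ⊆ (a, b)`, for `f` defined on `(a, b)`: the
extension of `U ↦ |Df|(U)` from open sets by outer regularity,
`|Df|(B) = inf {|Df|(U) : B ⊆ U ⊆ (a, b), U open}`. -/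
def totalVariation (f : ℝ → ℝ) (a b : ℝ) (B : Set ℝ) : ℝ≥0∞ :=
  ⨅ (U : Set ℝ) (_ : IsOpen U) (_ : B ⊆ U) (_ : U ⊆ Ioo a b), openVariation f U

end

/-!
Write `L = d - c`, `m` for the mean of `f` over `(c, d)`, and `F` for a primitive of `f`.

The oscillation depends continuously on the endpoints, so `μ` has no atoms and the oscillation is
additive over adjacent intervals: `osc f c d = M d - M c` with `M` continuous (`IsOscPotential`). The
means over the two halves of an interval differ by at most twice the oscillation; telescoping over a fine
grid gives `|f d - f c| ≤ 4 (M d - M c)` almost everywhere, so `f` may be taken continuous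
(`IsOscPotential.exists_continuousOn_ae_eq`).

If `f c = f d`, the variation of `f` on `[c, d]` is at least twice its range, whereas a continuous
nonconstant function has oscillation less than half its range; so `f` is constant on `[c, d]`. Flat pieces
spread, because just beyond one the oscillation is too small. Hence `f` is constant or strictly monotone
(`IsOscPotential.const_or_strictMono_or_strictAnti`), and it suffices to treat increasing `f`.

Then `F` is strictly convex and `L * osc / 2` is the maximal depth of `F` below its chord over `[c, d]`,
attained where `f = m`. The envelope theorem shows that `M` is `C¹`, and the arithmetic-geometric mean
inequality, together with the bound above, that `f' = 4 M'`. Eliminating the point where `f = m` from the two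
endpoint derivatives leaves, for `g = f'`, `Δ = f d - f c`, `u = f d - m`, `v = m - f c`,
`(g d * L + Δ) * v + (g c * L + Δ) * u = 8 * u * v` (`IsOscPotential.exists_hasDerivAt`). On intervals
`(x - t, x + t)`, with `B = ∫_{-t}^{t} s g(x + s) ds`, it says that the `t`-derivative of
`(Δ / t)² - (B / t²)²` vanishes, so that this quantity equals its limit `4 g(x)²` as `t → 0`
(`EndpointEquation.conserved`). So `g > 0`, and solving for `g(x)` at fixed `t` bootstraps `f` to a smooth
function. Expanding in `t` yields `3 g g'' = g'²` and `5 g''² + 3 g g⁗ = 4 g' g'''`. The first relation,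
differentiated twice, is compatible with the second only if `g'' = 0`, and then `g' = 0`
(`EndpointEquation.hasDerivAt_zero`).

Finally, for `f = p x + q` both `μ` and `|Df| / 4` are `|p| / 4` times Lebesgue measure
(`osc_affine`, `totalVariation_affine`).
-/

open Filter Topology

/-! ### Mean values and mean oscillations -/

theorem MeasureTheory.LocallyIntegrableOn.intervalIntegrable_of_mem_Ioo {f : ℝ → ℝ} {a b c d : ℝ}
    (hf : LocallyIntegrableOn f (Ioo a b) volume) (hc : c ∈ Ioo a b) (hd : d ∈ Ioo a b) :
    IntervalIntegrable f volume c d := by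
  rw [intervalIntegrable_iff']
  exact hf.integrableOn_compact_subset (ordConnected_Ioo.uIcc_subset hc hd) isCompact_uIcc

theorem meanValue_eq_intervalIntegral (f : ℝ → ℝ) {c d : ℝ} (h : c ≤ d) :
    meanValue f c d = (d - c)⁻¹ * ∫ x in c..d, f x := by
  rw [meanValue, intervalIntegral.integral_of_le h, integral_Ioc_eq_integral_Ioo]

theorem osc_eq_intervalIntegral (f : ℝ → ℝ) {c d : ℝ} (h : c ≤ d) :
    osc f c d = (d - c)⁻¹ * ∫ x in c..d, |f x - meanValue f c d| := by
  rw [osc, intervalIntegral.integral_of_le h, integral_Ioc_eq_integral_Ioo]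

theorem osc_self (f : ℝ → ℝ) (c : ℝ) : osc f c c = 0 := by simp [osc]

theorem osc_nonneg (f : ℝ → ℝ) {c d : ℝ} (h : c ≤ d) : 0 ≤ osc f c d :=
  mul_nonneg (inv_nonneg.2 (sub_nonneg.2 h)) (integral_nonneg fun _ => abs_nonneg _)

theorem osc_congr_ae {f g : ℝ → ℝ} {c d : ℝ} (h : f =ᵐ[volume.restrict (Ioo c d)] g) :
    osc f c d = osc g c d := by
  have hm : meanValue f c d = meanValue g c d := by
    rw [meanValue, meanValue, integral_congr_ae h]
  rw [osc, osc, hm]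
  congr 1
  refine integral_congr_ae ?_
  filter_upwards [h] with x hx
  simp [hx]

theorem osc_neg (f : ℝ → ℝ) (c d : ℝ) : osc (fun x => -f x) c d = osc f c d := by
  have hm : meanValue (fun x => -f x) c d = -meanValue f c d := by
    simp [meanValue, integral_neg]
  rw [osc, osc, hm]
  congr 2
  ext x
  rw [← abs_neg]
  congr 1
  ring

theorem osc_comp_neg (f : ℝ → ℝ) {c d : ℝ} (h : c ≤ d) :
    osc (fun x => f (-x)) (-d) (-c) = osc f c d := by
  have hm : meanValue (fun x => f (-x)) (-d) (-c) = meanValue f c d := by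
    rw [meanValue_eq_intervalIntegral _ (neg_le_neg h), meanValue_eq_intervalIntegral _ h,
      intervalIntegral.integral_comp_neg, neg_neg, neg_neg]
    congr 2
    ring
  rw [osc_eq_intervalIntegral _ (neg_le_neg h), osc_eq_intervalIntegral _ h, hm,
    intervalIntegral.integral_comp_neg (fun x => |f x - meanValue f c d|), neg_neg, neg_neg]
  congr 2
  ring

theorem integral_sub_meanValue {f : ℝ → ℝ} {c d : ℝ} (h : c < d)
    (hf : IntervalIntegrable f volume c d) : ∫ x in c..d, (f x - meanValue f c d) = 0 := by
  rw [intervalIntegral.integral_sub hf intervalIntegrable_const, meanValue_eq_intervalIntegral _ h.le,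
    intervalIntegral.integral_const, smul_eq_mul, mul_inv_cancel_left₀ (sub_pos.2 h).ne', sub_self]

/-- The means over the two halves of an interval differ by at most twice the mean oscillation. -/
theorem abs_integral_sub_integral_le_osc {f : ℝ → ℝ} {x h : ℝ} (hh : 0 < h)
    (hf : IntervalIntegrable f volume x (x + 2 * h)) :
    |(∫ t in x + h..x + 2 * h, f t) - ∫ t in x..x + h, f t| ≤ h * (2 * osc f x (x + 2 * h)) := by
  set m := meanValue f x (x + 2 * h) with hm
  have hx : x + h ∈ uIcc x (x + 2 * h) := by
    rw [uIcc_of_le (by linarith)]; constructor <;> linarith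
  have h1 : IntervalIntegrable f volume x (x + h) :=
    hf.mono_set (uIcc_subset_uIcc left_mem_uIcc hx)
  have h2 : IntervalIntegrable f volume (x + h) (x + 2 * h) :=
    hf.mono_set (uIcc_subset_uIcc hx right_mem_uIcc)
  have e1 : ∫ t in x..x + h, (f t - m) = (∫ t in x..x + h, f t) - h * m := by
    rw [intervalIntegral.integral_sub h1 intervalIntegrable_const]; simp
  have e2 : ∫ t in x + h..x + 2 * h, (f t - m) = (∫ t in x + h..x + 2 * h, f t) - h * m := by
    rw [intervalIntegral.integral_sub h2 intervalIntegrable_const]; simp; left; ring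
  have b1 := intervalIntegral.abs_integral_le_integral_abs (f := fun t => f t - m) (μ := volume)
    (show x ≤ x + h by linarith)
  have b2 := intervalIntegral.abs_integral_le_integral_abs (f := fun t => f t - m) (μ := volume)
    (show x + h ≤ x + 2 * h by linarith)
  have hs := intervalIntegral.integral_add_adjacent_intervals
    (h1.sub (intervalIntegrable_const (c := m))).abs (h2.sub (intervalIntegrable_const (c := m))).abs
  have ho : h * (2 * osc f x (x + 2 * h)) = ∫ t in x..x + 2 * h, |f t - m| := by
    rw [osc_eq_intervalIntegral _ (by linarith : x ≤ x + 2 * h), ← hm]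
    have : x + 2 * h - x ≠ 0 := by linarith
    field_simp
    ring
  rw [ho, ← hs]
  rw [e1] at b1
  rw [e2] at b2
  rw [abs_le] at *
  constructor <;> linarith [b1.1, b1.2, b2.1, b2.2]

theorem tendsto_osc_right {f : ℝ → ℝ} {a b c d : ℝ} (hf : LocallyIntegrableOn f (Ioo a b) volume)
    (hc : a < c) (hcd : c < d) (hd : d < b) : Tendsto (fun e => osc f c e) (𝓝 d) (𝓝 (osc f c d)) := by
  have hcm : c ∈ Ioo a b := ⟨hc, hcd.trans hd⟩
  have hdm : d ∈ Ioo a b := ⟨hc.trans hcd, hd⟩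
  have hprim : ∀ {g : ℝ → ℝ}, LocallyIntegrableOn g (Ioo a b) volume →
      Tendsto (fun e => ∫ x in c..e, g x) (𝓝 d) (𝓝 (∫ x in c..d, g x)) := by
    intro g hg
    obtain ⟨e, hde, heb⟩ := exists_between hd
    have hem : e ∈ Ioo a b := ⟨hdm.1.trans hde, heb⟩
    have hcont := intervalIntegral.continuousOn_primitive_interval (μ := volume) (f := g)
      (hg.integrableOn_compact_subset (ordConnected_Ioo.uIcc_subset hcm hem) isCompact_uIcc)
    exact (hcont.continuousAt (by
      rw [uIcc_of_le (hcd.trans hde).le]; exact Icc_mem_nhds hcd hde))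
  have hinv : Tendsto (fun e => (e - c)⁻¹) (𝓝 d) (𝓝 (d - c)⁻¹) :=
    (tendsto_id.sub_const c).inv₀ (sub_pos.2 hcd).ne'
  have hnear : ∀ᶠ e in 𝓝 d, e ∈ Ioo c b := Ioo_mem_nhds hcd hd
  have hmean : Tendsto (fun e => meanValue f c e) (𝓝 d) (𝓝 (meanValue f c d)) := by
    rw [meanValue_eq_intervalIntegral _ hcd.le]
    refine (hinv.mul (hprim hf)).congr' ?_
    filter_upwards [hnear] with e he
    rw [meanValue_eq_intervalIntegral _ he.1.le]
  set m := meanValue f c d with hm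
  have hfm : LocallyIntegrableOn (fun x => f x - m) (Ioo a b) volume :=
    hf.sub (locallyIntegrableOn_const m)
  -- Freezing the mean at `m` changes the integral over `(c, e)` by at most `(e - c) |m(e) - m|`.
  have hG : Tendsto (fun e => (e - c)⁻¹ * ∫ x in c..e, |f x - m|) (𝓝 d) (𝓝 (osc f c d)) := by
    rw [osc_eq_intervalIntegral _ hcd.le, ← hm]
    exact hinv.mul (hprim hfm.norm)
  have hdiff : Tendsto (fun e => osc f c e - (e - c)⁻¹ * ∫ x in c..e, |f x - m|) (𝓝 d) (𝓝 0) := by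
    have hz : Tendsto (fun e => |meanValue f c e - m|) (𝓝 d) (𝓝 0) := by
      simpa using (hmean.sub_const m).abs
    refine squeeze_zero_norm' ?_ hz
    filter_upwards [hnear] with e he
    have hpos : 0 < e - c := sub_pos.2 he.1
    have hi : IntervalIntegrable f volume c e :=
      hf.intervalIntegrable_of_mem_Ioo hcm ⟨hc.trans he.1, he.2⟩
    rw [osc_eq_intervalIntegral _ he.1.le, ← mul_sub, ← intervalIntegral.integral_sub
      (hi.sub intervalIntegrable_const).abs (hi.sub intervalIntegrable_const).abs, norm_mul,
      Real.norm_of_nonneg (inv_nonneg.2 hpos.le), inv_mul_le_iff₀ hpos, mul_comm (e - c)]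
    have := intervalIntegral.norm_integral_le_of_norm_le_const (a := c) (b := e)
      (f := fun x => |f x - meanValue f c e| - |f x - m|) (C := |meanValue f c e - m|) (by
        intro x _
        refine (abs_abs_sub_abs_le _ _).trans ?_
        rw [← abs_neg]
        apply le_of_eq; congr 1; ring)
    rwa [abs_of_pos hpos] at this
  simpa using hdiff.add hG

/-! ### Additivity of the oscillation -/

/-- If the oscillation is given by a measure, that measure has no atoms, because the oscillation
depends continuously on the endpoint; so the oscillation is additive over adjacent intervals. -/
theorem osc_add_osc_of_measure {a b : ℝ} {f : ℝ → ℝ}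
    (hf : LocallyIntegrableOn f (Ioo a b) volume) {μ : Measure (Ioo a b)}
    (hμ : ∀ c d : ℝ, a < c → c < d → d < b →
      μ (Subtype.val ⁻¹' Ioo c d) = ENNReal.ofReal (osc f c d))
    {c d e : ℝ} (hc : a < c) (hcd : c < d) (hde : d < e) (he : e < b) :
    osc f c e = osc f c d + osc f d e := by
  have meas : ∀ {s : Set ℝ}, MeasurableSet s →
      MeasurableSet (Subtype.val ⁻¹' s : Set (Ioo a b)) := fun hs => measurable_subtype_coe hs
  have split : ∀ e', d < e' → e' < b → ENNReal.ofReal (osc f c e') =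
      ENNReal.ofReal (osc f c d) + μ (Subtype.val ⁻¹' {d}) + ENNReal.ofReal (osc f d e') := by
    intro e' h1 h2
    have hU : Ioo c e' = (Ioo c d ∪ {d}) ∪ Ioo d e' := by
      ext x; simp only [mem_Ioo, mem_union, mem_singleton_iff]
      constructor
      · intro h
        rcases lt_trichotomy x d with h' | h' | h'
        · exact Or.inl (Or.inl ⟨h.1, h'⟩)
        · exact Or.inl (Or.inr h')
        · exact Or.inr ⟨h', h.2⟩
      · rintro ((h | h) | h)
        · exact ⟨h.1, h.2.trans h1⟩
        · subst h; exact ⟨hcd, h1⟩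
        · exact ⟨hcd.trans h.1, h.2⟩
    rw [← hμ c e' hc (hcd.trans h1) h2, ← hμ c d hc hcd (h1.trans h2),
      ← hμ d e' (hc.trans hcd) h1 h2, hU, preimage_union, preimage_union,
      measure_union _ (meas measurableSet_Ioo), measure_union _ (meas (measurableSet_singleton d))]
    · refine Disjoint.preimage _ (Set.disjoint_left.2 ?_)
      rintro x h h'
      rw [mem_singleton_iff.1 h'] at h; exact lt_irrefl _ h.2
    · rw [← preimage_union]
      refine Disjoint.preimage _ (Set.disjoint_left.2 ?_)
      rintro x (h | h) h'
      · exact lt_asymm h.2 h'.1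
      · rw [mem_singleton_iff.1 h] at h'; exact lt_irrefl _ h'.1
  have atom : μ (Subtype.val ⁻¹' {d}) = 0 := by
    have hlim : Tendsto (fun e' => ENNReal.ofReal (osc f c e')) (𝓝[>] d)
        (𝓝 (ENNReal.ofReal (osc f c d))) :=
      ENNReal.tendsto_ofReal ((tendsto_osc_right hf hc hcd (hde.trans he)).mono_left
        nhdsWithin_le_nhds)
    have hle : ENNReal.ofReal (osc f c d) + μ (Subtype.val ⁻¹' {d}) ≤
        ENNReal.ofReal (osc f c d) := by
      refine ge_of_tendsto hlim ?_
      filter_upwards [Ioo_mem_nhdsGT (hde.trans he)] with e' he'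
      rw [split e' he'.1 he'.2]
      exact le_self_add
    by_contra h0
    exact absurd hle (not_le.2 (ENNReal.lt_add_right ENNReal.ofReal_ne_top h0))
  have := split e hde he
  rw [atom, add_zero, ← ENNReal.ofReal_add (osc_nonneg f hcd.le) (osc_nonneg f hde.le)] at this
  exact (ENNReal.ofReal_eq_ofReal_iff (osc_nonneg f (hcd.trans hde).le)
    (add_nonneg (osc_nonneg f hcd.le) (osc_nonneg f hde.le))).1 this

/-- `M` is a distribution function of the oscillation on `(a, b)`: `osc f c d = M d - M c`. -/
def IsOscPotential (f M : ℝ → ℝ) (a b : ℝ) : Prop :=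
  ∀ c d, a < c → c < d → d < b → osc f c d = M d - M c

theorem exists_isOscPotential {a b : ℝ} (hab : a < b) {f : ℝ → ℝ}
    (hf : LocallyIntegrableOn f (Ioo a b) volume)
    (hadd : ∀ c d e : ℝ, a < c → c < d → d < e → e < b → osc f c e = osc f c d + osc f d e) :
    ∃ M : ℝ → ℝ, ContinuousOn M (Ioo a b) ∧ IsOscPotential f M a b := by
  obtain ⟨p, hap, hpb⟩ := exists_between hab
  let M : ℝ → ℝ := fun x => if p ≤ x then osc f p x else -osc f x p
  have hM : IsOscPotential f M a b := by
    intro c d hc hcd hd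
    simp only [M]
    split_ifs with h1 h2 h2
    · rcases h2.eq_or_lt with rfl | h2
      · simp [osc_self]
      · rw [hadd p c d hap h2 hcd hd]; ring
    · rcases h1.eq_or_lt with rfl | h1
      · simp [osc_self]
      · rw [hadd c p d hc (not_le.1 h2) h1 hd]; ring
    · exact absurd (h2.trans hcd.le) h1
    · rw [hadd c d p hc hcd (not_le.1 h1) hpb]; ring
  refine ⟨M, fun d hd => ?_, hM⟩
  obtain ⟨c, hac, hcd⟩ := exists_between hd.1
  refine ContinuousAt.continuousWithinAt ?_
  have hlim : Tendsto (fun e => M c + osc f c e) (𝓝 d) (𝓝 (M c + osc f c d)) :=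
    (tendsto_osc_right hf hac hcd hd.2).const_add _
  rw [hM c d hac hcd hd.2, add_sub_cancel] at hlim
  refine hlim.congr' ?_
  filter_upwards [Ioo_mem_nhds hcd hd.2] with e he
  rw [hM c e hac he.1 he.2, add_sub_cancel]

theorem IsOscPotential.mono {f M : ℝ → ℝ} {a b : ℝ} (hM : IsOscPotential f M a b) :
    MonotoneOn M (Ioo a b) := by
  intro c hc d hd hcd
  rcases hcd.eq_or_lt with rfl | h
  · rfl
  · have := hM c d hc.1 h hd.2
    linarith [osc_nonneg f h.le]

/-! ### The oscillation controls the variation -/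

/-- Telescoping the comparison of adjacent means along a grid of step `h`. -/
theorem IsOscPotential.abs_integral_shift_sub_le {f M : ℝ → ℝ} {a b : ℝ}
    (hf : LocallyIntegrableOn f (Ioo a b) volume) (hM : IsOscPotential f M a b)
    {x h : ℝ} (hx : a < x) (hh : 0 < h) (n : ℕ) (hn : x + (n + 1) * h < b) :
    |(∫ t in x + n * h..x + (n + 1) * h, f t) - ∫ t in x..x + h, f t| ≤
      h * (2 * (M (x + (n + 1) * h) + M (x + n * h) - M (x + h) - M x)) := by
  induction n with
  | zero => simp
  | succ n ih =>
    push_cast at hn ⊢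
    have hnh : 0 ≤ (n : ℝ) * h := by positivity
    have ih' := ih (by nlinarith)
    set y := x + n * h with hy
    have e1 : x + ((n : ℝ) + 1) * h = y + h := by rw [hy]; ring
    have e2 : x + ((n : ℝ) + 1 + 1) * h = y + 2 * h := by rw [hy]; ring
    rw [e2] at hn ⊢
    rw [e1] at ih' ⊢
    have hay : a < y := by linarith
    have key := abs_integral_sub_integral_le_osc hh
      (hf.intervalIntegrable_of_mem_Ioo (c := y) (d := y + 2 * h) ⟨hay, by linarith⟩
        ⟨by linarith, hn⟩)
    rw [hM y (y + 2 * h) hay (by linarith) hn] at key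
    rw [abs_le] at *
    constructor <;> linarith [key.1, key.2, ih'.1, ih'.2]

/-- At points of differentiability of the primitive, the variation of `f` is at most four times the
oscillation: this is the limit of the telescoped inequality as the step tends to zero. -/
theorem IsOscPotential.abs_sub_le {f M F : ℝ → ℝ} {a b c d : ℝ}
    (hf : LocallyIntegrableOn f (Ioo a b) volume) (hM : IsOscPotential f M a b)
    (hMc : ContinuousOn M (Ioo a b)) (hF : ∀ x ∈ Ioo a b, ∀ y ∈ Ioo a b, F y - F x = ∫ t in x..y, f t)
    (hc : a < c) (hcd : c < d) (hd : d < b)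
    (hFc : HasDerivAt F (f c) c) (hFd : HasDerivAt F (f d) d) :
    |f d - f c| ≤ 4 * (M d - M c) := by
  have hpos : 0 < d - c := sub_pos.2 hcd
  let s : ℕ → ℝ := fun n => (d - c) / ((n : ℝ) + 1)
  have hs0 : Tendsto s atTop (𝓝 0) := by
    have := (tendsto_one_div_add_atTop_nhds_zero_nat (𝕜 := ℝ)).const_mul (d - c)
    simpa [s, div_eq_mul_inv] using this
  have hspos : ∀ n, 0 < s n := fun n => by positivity
  have hs : Tendsto s atTop (𝓝[≠] 0) :=
    tendsto_nhdsWithin_iff.2 ⟨hs0, Eventually.of_forall fun n => (hspos n).ne'⟩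
  have lim : ∀ {x}, HasDerivAt F (f x) x →
      Tendsto (fun n => (s n)⁻¹ * (F (x + s n) - F x)) atTop (𝓝 (f x)) := by
    intro x hx
    exact (hasDerivAt_iff_tendsto_slope_zero.1 hx).comp hs
  have limM : ∀ {x}, x ∈ Ioo a b → Tendsto (fun n => M (x + s n)) atTop (𝓝 (M x)) := by
    intro x hx
    have h1 : Tendsto (fun n => x + s n) atTop (𝓝 x) := by simpa using hs0.const_add x
    exact ((hMc.continuousAt (isOpen_Ioo.mem_nhds hx)).tendsto).comp h1
  have hcm : c ∈ Ioo a b := ⟨hc, hcd.trans hd⟩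
  have hdm : d ∈ Ioo a b := ⟨hc.trans hcd, hd⟩
  have hL := ((lim hFd).sub (lim hFc)).abs
  have hR := (((limM hdm).add_const (M d)).sub (limM hcm)).sub_const (M c) |>.const_mul 2
  have : 4 * (M d - M c) = 2 * (M d + M d - M c - M c) := by ring
  rw [this]
  refine le_of_tendsto_of_tendsto hL hR ?_
  have hsb : ∀ᶠ n in atTop, d + s n < b := by
    have h1 : Tendsto (fun n => d + s n) atTop (𝓝 d) := by simpa using hs0.const_add d
    exact h1.eventually (gt_mem_nhds hd)
  filter_upwards [hsb] with n hn
  have e0 : ((n + 1 : ℕ) : ℝ) * s n = d - c := by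
    simp only [s]; push_cast; field_simp
  have e1 : c + ((n + 1 : ℕ) : ℝ) * s n = d := by rw [e0]; ring
  have e2 : c + (((n + 1 : ℕ) : ℝ) + 1) * s n = d + s n := by rw [add_mul, e0]; ring
  have key := hM.abs_integral_shift_sub_le hf hc (hspos n) (n + 1) (by rw [e2]; exact hn)
  have hcs : c + s n < b := by linarith
  rw [e1, e2, ← hF d hdm (d + s n) ⟨by linarith [hspos n, hdm.1], hn⟩,
    ← hF c hcm (c + s n) ⟨by linarith [hspos n], hcs⟩] at key
  rw [← mul_sub, abs_mul, abs_of_pos (inv_pos.2 (hspos n)), inv_mul_le_iff₀ (hspos n)]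
  exact key

/-- A locally integrable `f` whose oscillation has a continuous potential has a continuous
representative: off a null set, `f` is a Lipschitz function of the potential. -/
theorem IsOscPotential.exists_continuousOn_ae_eq {f M : ℝ → ℝ} {a b : ℝ} (hab : a < b)
    (hf : LocallyIntegrableOn f (Ioo a b) volume) (hM : IsOscPotential f M a b)
    (hMc : ContinuousOn M (Ioo a b)) :
    ∃ g : ℝ → ℝ, ContinuousOn g (Ioo a b) ∧ f =ᵐ[volume.restrict (Ioo a b)] g ∧
      ∀ c ∈ Ioo a b, ∀ d ∈ Ioo a b, |g d - g c| ≤ 4 * |M d - M c| := by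
  obtain ⟨p, hp⟩ := exists_between hab
  have hpm : p ∈ Ioo a b := hp
  let F : ℝ → ℝ := fun x => ∫ t in p..x, f t
  have hF : ∀ x ∈ Ioo a b, ∀ y ∈ Ioo a b, F y - F x = ∫ t in x..y, f t := by
    intro x hx y hy
    exact intervalIntegral.integral_interval_sub_left (hf.intervalIntegrable_of_mem_Ioo hpm hy)
      (hf.intervalIntegrable_of_mem_Ioo hpm hx)
  let S : Set ℝ := {x | x ∈ Ioo a b ∧ HasDerivAt F (f x) x}
  have hS : ∀ᵐ x ∂(volume.restrict (Ioo a b)), x ∈ S := by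
    rw [ae_restrict_iff' measurableSet_Ioo]
    obtain ⟨u, hu_anti, hu_mem, hu_lim⟩ := exists_seq_strictAnti_tendsto' hp.1
    obtain ⟨v, hv_mono, hv_mem, hv_lim⟩ := exists_seq_strictMono_tendsto' hp.2
    have hall : ∀ n, ∀ᵐ x, x ∈ uIcc (u n) (v n) → ∀ c ∈ uIcc (u n) (v n),
        HasDerivAt (fun x => ∫ t in c..x, f t) (f x) x := fun n =>
      (hf.intervalIntegrable_of_mem_Ioo ⟨(hu_mem n).1, (hu_mem n).2.trans hp.2⟩
        ⟨hp.1.trans (hv_mem n).1, (hv_mem n).2⟩).ae_hasDerivAt_integral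
    filter_upwards [ae_all_iff.2 hall] with x hx hxm
    refine ⟨hxm, ?_⟩
    obtain ⟨n, hn1, hn2⟩ := ((hu_lim.eventually (gt_mem_nhds hxm.1)).and
      (hv_lim.eventually (lt_mem_nhds hxm.2))).exists
    have hI : uIcc (u n) (v n) = Icc (u n) (v n) :=
      uIcc_of_le ((hu_mem n).2.trans (hv_mem n).1).le
    exact hx n (by rw [hI]; exact ⟨hn1.le, hn2.le⟩) p
      (by rw [hI]; exact ⟨(hu_mem n).2.le, (hv_mem n).1.le⟩)
  have hle : ∀ c ∈ S, ∀ d ∈ S, |f d - f c| ≤ 4 * |M d - M c| := by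
    have aux : ∀ c ∈ S, ∀ d ∈ S, c < d → |f d - f c| ≤ 4 * |M d - M c| := fun c hc d hd hcd =>
      (hM.abs_sub_le hf hMc hF hc.1.1 hcd hd.1.2 hc.2 hd.2).trans
        (mul_le_mul_of_nonneg_left (le_abs_self _) (by norm_num))
    intro c hc d hd
    rcases lt_trichotomy c d with h | rfl | h
    · exact aux c hc d hd h
    · simp
    · rw [abs_sub_comm, abs_sub_comm (M d)]; exact aux d hd c hc h
  -- On `S` the function factors through `M` as a `4`-Lipschitz function, which extends to `ℝ`.
  let r : ℝ → ℝ := Function.invFunOn M S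
  have hr : ∀ y ∈ M '' S, r y ∈ S ∧ M (r y) = y := fun y hy =>
    ⟨Function.invFunOn_mem hy, Function.invFunOn_eq hy⟩
  have hk : LipschitzOnWith 4 (fun y => f (r y)) (M '' S) := by
    refine LipschitzOnWith.of_dist_le_mul fun y hy z hz => ?_
    have := hle _ (hr z hz).1 _ (hr y hy).1
    rw [(hr z hz).2, (hr y hy).2] at this
    simpa [Real.dist_eq] using this
  obtain ⟨k, hkL, hke⟩ := hk.extend_real
  refine ⟨k ∘ M, hkL.continuous.comp_continuousOn hMc, ?_, fun c _ d _ => ?_⟩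
  · filter_upwards [hS] with x hx
    have hy : M x ∈ M '' S := mem_image_of_mem _ hx
    have h1 := hle x hx _ (hr _ hy).1
    rw [(hr _ hy).2, sub_self, abs_zero, mul_zero] at h1
    have h2 : f (r (M x)) = f x := sub_eq_zero.1 (abs_nonpos_iff.1 h1)
    exact h2.symm.trans (hke hy)
  · have := hkL.dist_le_mul (M d) (M c)
    simpa [Real.dist_eq] using this

/-! ### Continuous solutions are constant or strictly monotone -/

theorem meanValue_mem_Icc {f : ℝ → ℝ} {c d α β : ℝ} (hcd : c < d) (hf : ContinuousOn f (Icc c d))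
    (hα : ∀ x ∈ Icc c d, α ≤ f x) (hβ : ∀ x ∈ Icc c d, f x ≤ β) :
    meanValue f c d ∈ Icc α β := by
  have hi := hf.intervalIntegrable_of_Icc (μ := volume) hcd.le
  have hpos : 0 < d - c := sub_pos.2 hcd
  have h1 := intervalIntegral.integral_mono_on hcd.le
    (intervalIntegrable_const (μ := volume) (c := α)) hi hα
  have h2 := intervalIntegral.integral_mono_on hcd.le hi
    (intervalIntegrable_const (μ := volume) (c := β)) hβ
  rw [intervalIntegral.integral_const, smul_eq_mul] at h1 h2
  rw [meanValue_eq_intervalIntegral _ hcd.le]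
  exact ⟨(le_inv_mul_iff₀ hpos).2 h1, (inv_mul_le_iff₀ hpos).2 h2⟩

/-- A function with values in `[α, β]` has oscillation at most `(β - α) / 2`, with equality only if
it takes no value besides `α` and `β`; by continuity this is excluded once the midpoint is attained. -/
theorem osc_lt_half_of_mem_Icc {f : ℝ → ℝ} {c d α β : ℝ} (hcd : c < d)
    (hf : ContinuousOn f (Icc c d)) (hα : ∀ x ∈ Icc c d, α ≤ f x) (hβ : ∀ x ∈ Icc c d, f x ≤ β)
    (hαβ : α < β) (hk : ∃ k ∈ Icc c d, f k = (α + β) / 2) : osc f c d < (β - α) / 2 := by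
  have hpos : 0 < d - c := sub_pos.2 hcd
  have hi := hf.intervalIntegrable_of_Icc (μ := volume) hcd.le
  have hm := meanValue_mem_Icc hcd hf hα hβ
  have hzero := integral_sub_meanValue hcd hi
  set m := meanValue f c d with hmdef
  have hcont1 : ContinuousOn (fun x => (β - α) * |f x - m|) (Icc c d) := by fun_prop
  have hcont2 : ContinuousOn (fun x => 2 * (β - m) * (m - α) + (β + α - 2 * m) * (f x - m))
      (Icc c d) := by fun_prop
  -- The chord of `y ↦ (β - α) |y - m|` over `[α, β]` lies above it.
  have hle : ∀ x ∈ Icc c d,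
      (β - α) * |f x - m| ≤ 2 * (β - m) * (m - α) + (β + α - 2 * m) * (f x - m) := by
    intro x hx
    have h1 := hα x hx
    have h2 := hβ x hx
    have h3 := mul_nonneg (sub_nonneg.2 h2) (sub_nonneg.2 hm.1)
    have h4 := mul_nonneg (sub_nonneg.2 h1) (sub_nonneg.2 hm.2)
    rcases abs_cases (f x - m) with h | h <;> rw [h.1] <;> nlinarith
  have hint : ∫ x in c..d, (2 * (β - m) * (m - α) + (β + α - 2 * m) * (f x - m)) =
      (d - c) * (2 * (β - m) * (m - α)) := by
    rw [intervalIntegral.integral_add intervalIntegrable_const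
      ((hi.sub intervalIntegrable_const).const_mul _), intervalIntegral.integral_const_mul (β + α - 2 * m),
      hzero, intervalIntegral.integral_const]
    simp
  have ho : (d - c) * osc f c d = ∫ x in c..d, |f x - m| := by
    rw [osc_eq_intervalIntegral _ hcd.le, mul_inv_cancel_left₀ hpos.ne']
  have hmul : (β - α) * ((d - c) * osc f c d) = ∫ x in c..d, (β - α) * |f x - m| := by
    rw [ho, intervalIntegral.integral_const_mul]
  have hR : 0 < β - α := sub_pos.2 hαβ
  suffices (β - α) * ((d - c) * osc f c d) < (d - c) * ((β - α) ^ 2 / 2) by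
    have h' : (d - c) * (β - α) * osc f c d < (d - c) * (β - α) * ((β - α) / 2) := by nlinarith
    exact lt_of_mul_lt_mul_left h' (by positivity)
  by_cases hmm : α < m ∧ m < β
  · obtain ⟨k, hkm, hk⟩ := hk
    have hlt := intervalIntegral.integral_lt_integral_of_continuousOn_of_le_of_exists_lt hcd hcont1
      hcont2 (fun x hx => hle x (Ioc_subset_Icc_self hx)) ⟨k, hkm, by
        rw [hk]
        have h1 := mul_pos hR (sub_pos.2 hmm.1)
        have h2 := mul_pos hR (sub_pos.2 hmm.2)
        rcases abs_cases ((α + β) / 2 - m) with h | h <;> rw [h.1] <;> nlinarith⟩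
    rw [← hmul, hint] at hlt
    refine hlt.trans_le (mul_le_mul_of_nonneg_left ?_ hpos.le)
    nlinarith [sq_nonneg (β + α - 2 * m)]
  · have hlt := intervalIntegral.integral_mono_on hcd.le (hcont1.intervalIntegrable_of_Icc hcd.le)
      (hcont2.intervalIntegrable_of_Icc (μ := volume) hcd.le) hle
    rw [← hmul, hint] at hlt
    refine hlt.trans_lt (mul_lt_mul_of_pos_left ?_ hpos)
    have hz : (β - m) * (m - α) = 0 := by
      rcases not_and_or.1 hmm with h | h
      · rw [le_antisymm (not_lt.1 h) hm.1]; ring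
      · rw [le_antisymm hm.2 (not_lt.1 h)]; ring
    rw [mul_assoc, hz, mul_zero]
    positivity

/-- A function that returns to a value has variation at least twice its range, which is too much
for the oscillation unless the function is constant in between. -/
theorem IsOscPotential.eq_of_endpoints_eq {f M : ℝ → ℝ} {a b c d : ℝ} (hM : IsOscPotential f M a b)
    (hf : ContinuousOn f (Ioo a b))
    (hvar : ∀ c d, a < c → c ≤ d → d < b → |f d - f c| ≤ 4 * (M d - M c))
    (hc : a < c) (hcd : c < d) (hd : d < b) (heq : f c = f d) : ∀ x ∈ Icc c d, f x = f c := by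
  have hsub : Icc c d ⊆ Ioo a b := fun x hx => ⟨hc.trans_le hx.1, hx.2.trans_lt hd⟩
  have hfc := hf.mono hsub
  obtain ⟨x₁, hx₁, hmax⟩ := isCompact_Icc.exists_isMaxOn (nonempty_Icc.2 hcd.le) hfc
  obtain ⟨x₂, hx₂, hmin⟩ := isCompact_Icc.exists_isMinOn (nonempty_Icc.2 hcd.le) hfc
  have hmax' : ∀ x ∈ Icc c d, f x ≤ f x₁ := fun x hx => hmax hx
  have hmin' : ∀ x ∈ Icc c d, f x₂ ≤ f x := fun x hx => hmin hx
  have hcm : c ∈ Icc c d := left_mem_Icc.2 hcd.le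
  suffices f x₂ = f x₁ by
    intro x hx
    have h1 := hmax' x hx; have h2 := hmin' x hx
    have h3 := hmax' c hcm; have h4 := hmin' c hcm
    linarith
  by_contra hne
  have hlt : f x₂ < f x₁ := lt_of_le_of_ne (hmin' x₁ hx₁) hne
  have hk : ∃ k ∈ Icc c d, f k = (f x₂ + f x₁) / 2 := by
    have := isPreconnected_Icc.intermediate_value hx₂ hx₁ hfc
    obtain ⟨k, hk, e⟩ := this (show (f x₂ + f x₁) / 2 ∈ Icc (f x₂) (f x₁) by
      constructor <;> linarith)
    exact ⟨k, hk, e⟩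
  have ho := osc_lt_half_of_mem_Icc hcd hfc hmin' hmax' hlt hk
  rw [hM c d hc hcd hd] at ho
  rcases le_total x₁ x₂ with h | h
  · have a1 := (abs_le.1 (hvar c x₁ hc hx₁.1 (hsub hx₁).2)).2
    have a2 := (abs_le.1 (hvar x₁ x₂ (hsub hx₁).1 h (hsub hx₂).2)).1
    have a3 := (abs_le.1 (hvar x₂ d (hsub hx₂).1 hx₂.2 hd)).2
    linarith
  · have a1 := (abs_le.1 (hvar c x₂ hc hx₂.1 (hsub hx₂).2)).1
    have a2 := (abs_le.1 (hvar x₂ x₁ (hsub hx₂).1 h (hsub hx₁).2)).2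
    have a3 := (abs_le.1 (hvar x₁ d (hsub hx₁).1 hx₁.2 hd)).1
    linarith

theorem osc_le_of_eq_on_left {f : ℝ → ℝ} {c d t K : ℝ} (hcd : c < d) (hdt : d ≤ t)
    (hf : ContinuousOn f (Icc c t)) (hflat : ∀ x ∈ Icc c d, f x = f c)
    (hK : ∀ x ∈ Icc c t, |f x - f c| ≤ K) : (t - c) * osc f c t ≤ 2 * ((t - d) * K) := by
  have hct : c < t := hcd.trans_le hdt
  have hpos : 0 < t - c := sub_pos.2 hct
  have hi := hf.intervalIntegrable_of_Icc (μ := volume) hct.le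
  have hd : d ∈ uIcc c t := by rw [uIcc_of_le hct.le]; exact ⟨hcd.le, hdt⟩
  have hi1 : IntervalIntegrable f volume c d := hi.mono_set (uIcc_subset_uIcc left_mem_uIcc hd)
  have hi2 : IntervalIntegrable f volume d t := hi.mono_set (uIcc_subset_uIcc hd right_mem_uIcc)
  have hk : IntervalIntegrable (fun _ => f c) volume c t := intervalIntegrable_const
  have hdev : ∫ x in c..t, |f x - f c| ≤ (t - d) * K := by
    have hz : ∫ x in c..d, |f x - f c| = 0 := by
      rw [intervalIntegral.integral_congr (g := fun _ => (0 : ℝ))]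
      · simp
      · intro x hx
        rw [uIcc_of_le hcd.le] at hx
        simp [hflat x hx]
    have h2 := intervalIntegral.integral_mono_on hdt
      (hi2.sub (intervalIntegrable_const (c := f c))).abs
      (intervalIntegrable_const (μ := volume) (c := K)) (fun x hx => hK x ⟨hcd.le.trans hx.1, hx.2⟩)
    rw [← intervalIntegral.integral_add_adjacent_intervals
      (hi1.sub (intervalIntegrable_const (c := f c))).abs
      (hi2.sub (intervalIntegrable_const (c := f c))).abs, hz, zero_add]
    simpa using h2
  have hmean : (t - c) * |meanValue f c t - f c| ≤ (t - d) * K := by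
    have : (t - c) * (meanValue f c t - f c) = ∫ x in c..t, (f x - f c) := by
      rw [intervalIntegral.integral_sub hi hk, meanValue_eq_intervalIntegral _ hct.le, mul_sub,
        mul_inv_cancel_left₀ hpos.ne']
      simp
    rw [show (t - c) * |meanValue f c t - f c| = |(t - c) * (meanValue f c t - f c)| by
      rw [abs_mul, abs_of_pos hpos], this]
    exact (intervalIntegral.abs_integral_le_integral_abs hct.le).trans hdev
  have ho : (t - c) * osc f c t = ∫ x in c..t, |f x - meanValue f c t| := by
    rw [osc_eq_intervalIntegral _ hct.le, mul_inv_cancel_left₀ hpos.ne']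
  have hle := intervalIntegral.integral_mono_on hct.le
    (hi.sub (intervalIntegrable_const (c := meanValue f c t))).abs
    ((hi.sub (intervalIntegrable_const (c := f c))).abs.add
      (intervalIntegrable_const (c := |meanValue f c t - f c|)))
    (fun x _ => by
      have := abs_sub_le (f x) (f c) (meanValue f c t)
      rwa [abs_sub_comm (f c)] at this)
  rw [intervalIntegral.integral_add (hi.sub (intervalIntegrable_const (c := f c))).abs
    intervalIntegrable_const, intervalIntegral.integral_const, smul_eq_mul] at hle
  rw [ho]
  linarith

/-- A flat piece propagates to the right: just past it, the oscillation over the whole interval is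
small compared with the deviation from the flat value. -/
theorem eq_right_of_flat {f : ℝ → ℝ} {a b c d : ℝ} (hf : ContinuousOn f (Ioo a b))
    (hosc : ∀ c d, a < c → c < d → d < b → |f d - f c| ≤ 4 * osc f c d)
    (hc : a < c) (hcd : c < d) (hflat : ∀ x ∈ Icc c d, f x = f c) :
    ∀ T, d ≤ T → T < b → f T = f c := by
  intro T hdT hT
  have hsub : Icc d T ⊆ Ioo a b := fun x hx => ⟨(hc.trans hcd).trans_le hx.1, hx.2.trans_lt hT⟩
  let S : Set ℝ := {t | ∀ x ∈ Icc d t, f x = f c}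
  have hS : Icc d T ⊆ S := by
    have hclosed : IsClosed (S ∩ Icc d T) := by
      refine isClosed_of_closure_subset fun t ht => ?_
      have htI : t ∈ Icc d T := isClosed_Icc.closure_subset_iff.2 inter_subset_right ht
      refine ⟨?_, htI⟩
      have hlt : ∀ x ∈ Ico d t, f x = f c := by
        intro x hx
        obtain ⟨s, hs, hxs⟩ := mem_closure_iff_nhds.1 ht (Ioi x) (Ioi_mem_nhds hx.2)
        exact hxs.1 x ⟨hx.1, hs.le⟩
      intro x hx
      rcases hx.2.eq_or_lt with rfl | hxt
      · rcases hx.1.eq_or_lt with rfl | hdx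
        · exact hflat _ ⟨hcd.le, le_rfl⟩
        have hcont : Tendsto f (𝓝[<] x) (𝓝 (f x)) :=
          ((hf.continuousAt (isOpen_Ioo.mem_nhds (hsub htI))).tendsto).mono_left nhdsWithin_le_nhds
        refine tendsto_nhds_unique (hcont.congr' ?_) tendsto_const_nhds
        filter_upwards [Ioo_mem_nhdsLT hdx] with y hy
        exact hlt y ⟨hy.1.le, hy.2⟩
      · exact hlt x ⟨hx.1, hxt⟩
    refine hclosed.Icc_subset_of_forall_exists_gt (fun x hx => ?_) (fun t ht y hy => ?_)
    · rw [le_antisymm hx.2 hx.1]; exact hflat d ⟨hcd.le, le_rfl⟩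
    · -- If `f = f c` on `[c, t]`, the same holds on `[c, s]` for every `s < t + (t - c) / 8`.
      have hct : c < t := hcd.trans_le ht.2.1
      have hflat' : ∀ x ∈ Icc c t, f x = f c := fun x hx => by
        rcases le_total x d with h | h
        · exact hflat x ⟨hx.1, h⟩
        · exact ht.1 x ⟨h, hx.2⟩
      obtain ⟨s, hts, hs⟩ := exists_between
        (lt_min (lt_min ht.2.2 hy) (show t < t + (t - c) / 8 by linarith))
      rw [lt_min_iff, lt_min_iff] at hs
      refine ⟨s, fun x hx => ?_, hts, hs.1.2.le⟩
      have hcs : c < s := hct.trans hts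
      have hsub' : Icc c s ⊆ Ioo a b := fun x hx =>
        ⟨hc.trans_le hx.1, hx.2.trans_lt (hs.1.1.trans hT)⟩
      have hfs := hf.mono hsub'
      obtain ⟨z, hz, hzmax⟩ := isCompact_Icc.exists_isMaxOn (nonempty_Icc.2 hcs.le)
        (hfs.sub continuousOn_const).abs (f := fun x => |f x - f c|)
      have hzmax' : ∀ x ∈ Icc c s, |f x - f c| ≤ |f z - f c| := fun x hx => hzmax hx
      have hK0 : |f z - f c| ≤ 0 := by
        rcases le_total z t with h | h
        · rw [hflat' z ⟨hz.1, h⟩]; simp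
        have hcz : c < z := hct.trans_le h
        have h1 := hosc c z hc hcz (hsub' hz).2
        have h2 := osc_le_of_eq_on_left hct h (hf.mono fun x hx => hsub' ⟨hx.1, hx.2.trans hz.2⟩)
          hflat' (fun x hx => hzmax' x ⟨hx.1, hx.2.trans hz.2⟩)
        have hzs := hz.2
        have h3 := abs_nonneg (f z - f c)
        nlinarith
      have := (hzmax' x ⟨hcd.le.trans hx.1, hx.2⟩).trans hK0
      exact sub_eq_zero.1 (abs_nonpos_iff.1 this)
  exact hS (right_mem_Icc.2 hdT) T (right_mem_Icc.2 hdT)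

theorem eq_of_flat {f : ℝ → ℝ} {a b c d : ℝ} (hf : ContinuousOn f (Ioo a b))
    (hosc : ∀ c d, a < c → c < d → d < b → |f d - f c| ≤ 4 * osc f c d)
    (hc : a < c) (hcd : c < d) (hd : d < b) (hflat : ∀ x ∈ Icc c d, f x = f c) :
    ∀ x ∈ Ioo a b, f x = f c := by
  intro x hx
  rcases le_total d x with h | h
  · exact eq_right_of_flat hf hosc hc hcd hflat x h hx.2
  rcases le_total c x with h' | h'
  · exact hflat x ⟨h', h⟩
  -- The left side follows by reflection.
  have hfd : f d = f c := hflat d ⟨hcd.le, le_rfl⟩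
  have := eq_right_of_flat (f := fun x => f (-x)) (a := -b) (b := -a) (c := -d) (d := -c)
    (hf.comp continuous_neg.continuousOn fun y hy => ⟨by linarith [hy.2], by linarith [hy.1]⟩)
    (fun c d h1 h2 h3 => by
      have h := hosc (-d) (-c) (by linarith) (by linarith) (by linarith)
      have e := osc_comp_neg f (c := -d) (d := -c) (by linarith)
      rw [neg_neg, neg_neg] at e
      rw [e, abs_sub_comm]; exact h)
    (by linarith) (by linarith)
    (fun y hy => by
      have h := hflat (-y) ⟨by linarith [hy.2], by linarith [hy.1]⟩
      simp only [neg_neg]; rw [h, hfd]) (-x) (by linarith) (by linarith [hx.1])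
  simp only [neg_neg] at this
  rw [this, hfd]

theorem IsOscPotential.const_or_strictMono_or_strictAnti {f M : ℝ → ℝ} {a b : ℝ} (hab : a < b)
    (hM : IsOscPotential f M a b) (hf : ContinuousOn f (Ioo a b))
    (hvar : ∀ c d, a < c → c ≤ d → d < b → |f d - f c| ≤ 4 * (M d - M c)) :
    (∃ k, ∀ x ∈ Ioo a b, f x = k) ∨ StrictMonoOn f (Ioo a b) ∨ StrictAntiOn f (Ioo a b) := by
  by_cases hinj : InjOn f (Ioo a b)
  · exact Or.inr (hf.strictMonoOn_of_injOn_Ioo hab hinj)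
  left
  have hosc : ∀ c d, a < c → c < d → d < b → |f d - f c| ≤ 4 * osc f c d := fun c d h1 h2 h3 => by
    rw [hM c d h1 h2 h3]; exact hvar c d h1 h2.le h3
  have key : ∀ c ∈ Ioo a b, ∀ d ∈ Ioo a b, c < d → f c = f d → ∃ k, ∀ x ∈ Ioo a b, f x = k :=
    fun c hc d hd hcd h => ⟨f c, eq_of_flat hf hosc hc.1 hcd hd.2
      (hM.eq_of_endpoints_eq hf hvar hc.1 hcd hd.2 h)⟩
  simp only [InjOn, not_forall] at hinj
  obtain ⟨c, hc, d, hd, h, hne⟩ := hinj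
  rcases lt_or_gt_of_ne hne with h' | h'
  · exact key c hc d hd h' h
  · exact key d hd c hc h' h.symm

/-! ### Increasing solutions are continuously differentiable -/

/-- Envelope theorem: if `K e` is the maximum over `y` of expressions that are affine in `m e` with
slope `y`, attained at `Y e`, then only the variation of `m` contributes to the derivative of `K`. -/
theorem hasDerivAt_of_envelope {K m Y : ℝ → ℝ} {x m' : ℝ} (hm : HasDerivAt m m' x)
    (hY : ContinuousAt Y x) (hlow : ∀ᶠ e in 𝓝 x, (m e - m x) * Y x ≤ K e - K x)
    (hupp : ∀ᶠ e in 𝓝 x, K e - K x ≤ (m e - m x) * Y e) : HasDerivAt K (m' * Y x) x := by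
  have h1 : (fun e => K e - K x - (m e - m x) * Y x) =o[𝓝 x] fun e => e - x := by
    have h2 : (fun e => (m e - m x) * (Y e - Y x)) =o[𝓝 x] fun e => (e - x) * 1 := by
      refine hm.isBigO_sub.mul_isLittleO ?_
      rw [Asymptotics.isLittleO_one_iff]
      simpa using hY.tendsto.sub_const (Y x)
    simp only [mul_one] at h2
    refine (Asymptotics.IsBigO.of_bound 1 ?_).trans_isLittleO h2
    filter_upwards [hlow, hupp] with e h3 h4
    rw [one_mul, Real.norm_of_nonneg (by linarith)]
    refine le_trans ?_ (le_abs_self _)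
    linarith
  have h2 := hm.mul_const (Y x)
  rw [hasDerivAt_iff_isLittleO] at h2 ⊢
  refine (h1.add h2).congr (fun e => ?_) fun e => rfl
  simp only [smul_eq_mul]
  ring

theorem StrictMonoOn.continuousAt_of_comp {f Y : ℝ → ℝ} {a b x : ℝ} (hf : StrictMonoOn f (Ioo a b))
    (hY : ∀ᶠ e in 𝓝 x, Y e ∈ Ioo a b) (hfY : ContinuousAt (fun e => f (Y e)) x) :
    ContinuousAt Y x := by
  have hx : Y x ∈ Ioo a b := hY.self_of_nhds
  refine tendsto_order.2 ⟨fun l hl => ?_, fun l hl => ?_⟩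
  · obtain ⟨k, hk1, hk2⟩ := exists_between (max_lt hl hx.1)
    rw [max_lt_iff] at hk1
    have hk : k ∈ Ioo a b := ⟨hk1.2, hk2.trans hx.2⟩
    filter_upwards [hY, hfY.eventually (lt_mem_nhds (hf hk hx hk2))] with e he1 he2
    exact hk1.1.trans ((hf.lt_iff_lt hk he1).1 he2)
  · obtain ⟨k, hk1, hk2⟩ := exists_between (lt_min hl hx.2)
    rw [lt_min_iff] at hk2
    have hk : k ∈ Ioo a b := ⟨hx.1.trans hk1, hk2.2⟩
    filter_upwards [hY, hfY.eventually (gt_mem_nhds (hf hx hk hk1))] with e he1 he2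
    exact ((hf.lt_iff_lt he1 hk).1 he2).trans hk2.1

section Chord

variable {f F M : ℝ → ℝ} {a b : ℝ}

theorem integral_eq_sub_of_hasDerivAt_Ioo (hf : ContinuousOn f (Ioo a b))
    (hF : ∀ x ∈ Ioo a b, HasDerivAt F (f x) x) {c d : ℝ} (hc : c ∈ Ioo a b) (hd : d ∈ Ioo a b) :
    ∫ x in c..d, f x = F d - F c := by
  have hsub := ordConnected_Ioo.uIcc_subset hc hd
  exact intervalIntegral.integral_eq_sub_of_hasDerivAt (fun x hx => hF x (hsub hx))
    (hf.mono hsub).intervalIntegrable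

theorem meanValue_eq_slope (hf : ContinuousOn f (Ioo a b))
    (hF : ∀ x ∈ Ioo a b, HasDerivAt F (f x) x) {c d : ℝ} (hc : a < c) (hcd : c < d) (hd : d < b) :
    meanValue f c d = (F d - F c) / (d - c) := by
  rw [meanValue_eq_intervalIntegral _ hcd.le, integral_eq_sub_of_hasDerivAt_Ioo hf hF
    ⟨hc, hcd.trans hd⟩ ⟨hc.trans hcd, hd⟩, div_eq_inv_mul]

theorem chord_sub_le_osc (hf : ContinuousOn f (Ioo a b))
    (hF : ∀ x ∈ Ioo a b, HasDerivAt F (f x) x) {c d x : ℝ} (hc : a < c) (hcd : c < d) (hd : d < b)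
    (hx : x ∈ Icc c d) :
    (F d - F c) / (d - c) * (x - c) - (F x - F c) ≤ (d - c) / 2 * osc f c d := by
  have hcm : c ∈ Ioo a b := ⟨hc, hcd.trans hd⟩
  have hdm : d ∈ Ioo a b := ⟨hc.trans hcd, hd⟩
  have hxm : x ∈ Ioo a b := ⟨hc.trans_le hx.1, hx.2.trans_lt hd⟩
  have hpos : 0 < d - c := sub_pos.2 hcd
  rw [osc_eq_intervalIntegral _ hcd.le, meanValue_eq_slope hf hF hc hcd hd]
  set m := (F d - F c) / (d - c) with hm
  have hint : ∀ {p q}, p ∈ Ioo a b → q ∈ Ioo a b → IntervalIntegrable f volume p q :=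
    fun hp hq => (hf.mono (ordConnected_Ioo.uIcc_subset hp hq)).intervalIntegrable
  have h1 := intervalIntegral.integral_add_adjacent_intervals
    ((hint hcm hxm).sub (intervalIntegrable_const (c := m))).abs
    ((hint hxm hdm).sub (intervalIntegrable_const (c := m))).abs
  have h2 := (abs_le.1 (intervalIntegral.abs_integral_le_integral_abs
    (f := fun t => f t - m) (μ := volume) hx.1)).1
  have h3 := (abs_le.1 (intervalIntegral.abs_integral_le_integral_abs
    (f := fun t => f t - m) (μ := volume) hx.2)).2
  rw [intervalIntegral.integral_sub (hint hcm hxm) intervalIntegrable_const,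
    integral_eq_sub_of_hasDerivAt_Ioo hf hF hcm hxm, intervalIntegral.integral_const, smul_eq_mul]
    at h2
  rw [intervalIntegral.integral_sub (hint hxm hdm) intervalIntegrable_const,
    integral_eq_sub_of_hasDerivAt_Ioo hf hF hxm hdm, intervalIntegral.integral_const, smul_eq_mul]
    at h3
  have hmL : m * (d - c) = F d - F c := by rw [hm]; field_simp
  rw [show (d - c) / 2 * ((d - c)⁻¹ * ∫ x in c..d, |f x - m|) = (∫ x in c..d, |f x - m|) / 2 by
    field_simp, ← h1]
  nlinarith

/-- For increasing `f`, the convex primitive `F` lies furthest below its chord where `f` equals its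
mean, and the depth there is half the length times the oscillation. -/
theorem chord_sub_eq_osc (hf : ContinuousOn f (Ioo a b)) (hmono : StrictMonoOn f (Ioo a b))
    (hF : ∀ x ∈ Ioo a b, HasDerivAt F (f x) x) {c d x : ℝ} (hc : a < c) (hcd : c < d) (hd : d < b)
    (hx : x ∈ Icc c d) (hfx : f x = (F d - F c) / (d - c)) :
    (F d - F c) / (d - c) * (x - c) - (F x - F c) = (d - c) / 2 * osc f c d := by
  have hcm : c ∈ Ioo a b := ⟨hc, hcd.trans hd⟩
  have hdm : d ∈ Ioo a b := ⟨hc.trans hcd, hd⟩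
  have hxm : x ∈ Ioo a b := ⟨hc.trans_le hx.1, hx.2.trans_lt hd⟩
  have hpos : 0 < d - c := sub_pos.2 hcd
  rw [osc_eq_intervalIntegral _ hcd.le, meanValue_eq_slope hf hF hc hcd hd]
  set m := (F d - F c) / (d - c) with hm
  have hint : ∀ {p q}, p ∈ Ioo a b → q ∈ Ioo a b → IntervalIntegrable f volume p q :=
    fun hp hq => (hf.mono (ordConnected_Ioo.uIcc_subset hp hq)).intervalIntegrable
  have h1 := intervalIntegral.integral_add_adjacent_intervals
    ((hint hcm hxm).sub (intervalIntegrable_const (c := m))).abs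
    ((hint hxm hdm).sub (intervalIntegrable_const (c := m))).abs
  have h2 : ∫ t in c..x, |f t - m| = m * (x - c) - (F x - F c) := by
    rw [intervalIntegral.integral_congr (g := fun t => m - f t),
      intervalIntegral.integral_sub intervalIntegrable_const (hint hcm hxm),
      integral_eq_sub_of_hasDerivAt_Ioo hf hF hcm hxm, intervalIntegral.integral_const,
      smul_eq_mul, mul_comm]
    intro t ht
    rw [uIcc_of_le hx.1] at ht
    have := hmono.monotoneOn ⟨hc.trans_le ht.1, ht.2.trans_lt hxm.2⟩ hxm ht.2
    change |f t - m| = m - f t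
    rw [abs_of_nonpos (by linarith)]; ring
  have h3 : ∫ t in x..d, |f t - m| = F d - F x - m * (d - x) := by
    rw [intervalIntegral.integral_congr (g := fun t => f t - m),
      intervalIntegral.integral_sub (hint hxm hdm) intervalIntegrable_const,
      integral_eq_sub_of_hasDerivAt_Ioo hf hF hxm hdm, intervalIntegral.integral_const,
      smul_eq_mul, mul_comm m]
    intro t ht
    rw [uIcc_of_le hx.2] at ht
    have := hmono.monotoneOn hxm ⟨hxm.1.trans_le ht.1, ht.2.trans_lt hd⟩ ht.1
    exact abs_of_nonneg (by linarith)
  have hmL : m * (d - c) = F d - F c := by rw [hm]; field_simp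
  rw [show (d - c) / 2 * ((d - c)⁻¹ * ∫ x in c..d, |f x - m|) = (∫ x in c..d, |f x - m|) / 2 by
    field_simp, ← h1, h2, h3]
  linarith

theorem hasDerivAt_slope_right (hF : ∀ x ∈ Ioo a b, HasDerivAt F (f x) x) {c d : ℝ} (hcd : c < d)
    (hd : d ∈ Ioo a b) : HasDerivAt (fun e => (F e - F c) / (e - c))
      ((f d - (F d - F c) / (d - c)) / (d - c)) d := by
  have hpos : d - c ≠ 0 := (sub_pos.2 hcd).ne'
  refine HasDerivAt.congr_deriv (((hF d hd).sub_const (F c)).div ((hasDerivAt_id d).sub_const c) hpos) ?_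
  field_simp

theorem hasDerivAt_slope_left (hF : ∀ x ∈ Ioo a b, HasDerivAt F (f x) x) {c d : ℝ} (hcd : c < d)
    (hc : c ∈ Ioo a b) : HasDerivAt (fun e => (F d - F e) / (d - e))
      (((F d - F c) / (d - c) - f c) / (d - c)) c := by
  have hpos : d - c ≠ 0 := (sub_pos.2 hcd).ne'
  refine HasDerivAt.congr_deriv (((hF c hc).const_sub (F d)).div ((hasDerivAt_id c).const_sub d) hpos) ?_
  field_simp
  ring

/-- The envelope theorem in the right endpoint. Here `X c d` is the point where `f` equals its mean over
`(c, d)`. -/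
theorem IsOscPotential.hasDerivAt_right (hM : IsOscPotential f M a b) (hf : ContinuousOn f (Ioo a b))
    (hmono : StrictMonoOn f (Ioo a b)) (hF : ∀ x ∈ Ioo a b, HasDerivAt F (f x) x) {X : ℝ → ℝ → ℝ}
    (hX : ∀ c d, a < c → c < d → d < b → X c d ∈ Ioo c d ∧ f (X c d) = (F d - F c) / (d - c))
    {c d : ℝ} (hc : a < c) (hcd : c < d) (hd : d < b) :
    ContinuousAt (fun e => X c e) d ∧ HasDerivAt M
      ((2 * (f d - (F d - F c) / (d - c)) * (X c d - c) / (d - c) - (M d - M c)) / (d - c)) d := by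
  have hdm : d ∈ Ioo a b := ⟨hc.trans hcd, hd⟩
  have hpos : 0 < d - c := sub_pos.2 hcd
  have hm := hasDerivAt_slope_right hF hcd hdm
  have hnear : ∀ᶠ e in 𝓝 d, e ∈ Ioo (X c d) b := Ioo_mem_nhds (hX c d hc hcd hd).1.2 hd
  have hnear' : ∀ᶠ e in 𝓝 d, c < e ∧ e < b := by
    filter_upwards [hnear] with e he using ⟨(hX c d hc hcd hd).1.1.trans he.1, he.2⟩
  have hXc : ContinuousAt (fun e => X c e) d := by
    refine hmono.continuousAt_of_comp ?_ (hm.continuousAt.congr ?_)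
    · filter_upwards [hnear'] with e he
      have := (hX c e hc he.1 he.2).1
      exact ⟨hc.trans this.1, this.2.trans he.2⟩
    · filter_upwards [hnear'] with e he
      exact (hX c e hc he.1 he.2).2.symm
  have hK : HasDerivAt (fun e => (e - c) / 2 * (M e - M c))
      ((f d - (F d - F c) / (d - c)) / (d - c) * (X c d - c)) d := by
    refine hasDerivAt_of_envelope (Y := fun e => X c e - c) hm (hXc.sub continuousAt_const) ?_ ?_
    · filter_upwards [hnear', hnear, hXc.eventually (gt_mem_nhds (hX c d hc hcd hd).1.2)]
        with e he he2 he3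
      have h1 := chord_sub_le_osc hf hF hc he.1 he.2
        (x := X c d) ⟨(hX c d hc hcd hd).1.1.le, he2.1.le⟩
      have h2 := chord_sub_eq_osc hf hmono hF hc hcd hd
        (Ioo_subset_Icc_self (hX c d hc hcd hd).1) (hX c d hc hcd hd).2
      rw [hM c e hc he.1 he.2] at h1
      rw [hM c d hc hcd hd] at h2
      linarith
    · filter_upwards [hnear', hnear, hXc.eventually (gt_mem_nhds (hX c d hc hcd hd).1.2)]
        with e he he2 he3
      have h1 := chord_sub_eq_osc hf hmono hF hc he.1 he.2
        (Ioo_subset_Icc_self (hX c e hc he.1 he.2).1) (hX c e hc he.1 he.2).2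
      have h2 := chord_sub_le_osc hf hF hc hcd hd
        (x := X c e) ⟨(hX c e hc he.1 he.2).1.1.le, he3.le⟩
      rw [hM c e hc he.1 he.2] at h1
      rw [hM c d hc hcd hd] at h2
      linarith
  refine ⟨hXc, ?_⟩
  have hdiv := ((hK.const_mul 2).div ((hasDerivAt_id d).sub_const c) hpos.ne').const_add (M c)
  refine HasDerivAt.congr_of_eventuallyEq (hdiv.congr_deriv ?_) ?_
  · simp only [id]; field_simp
  · filter_upwards [hnear'] with e he
    have : e - c ≠ 0 := (sub_pos.2 he.1).ne'
    simp only [Pi.div_apply, id]; field_simp; ring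

/-- The envelope theorem in the left endpoint. -/
theorem IsOscPotential.hasDerivAt_left (hM : IsOscPotential f M a b) (hf : ContinuousOn f (Ioo a b))
    (hmono : StrictMonoOn f (Ioo a b)) (hF : ∀ x ∈ Ioo a b, HasDerivAt F (f x) x) {X : ℝ → ℝ → ℝ}
    (hX : ∀ c d, a < c → c < d → d < b → X c d ∈ Ioo c d ∧ f (X c d) = (F d - F c) / (d - c))
    {c d : ℝ} (hc : a < c) (hcd : c < d) (hd : d < b) :
    HasDerivAt M
      ((2 * ((F d - F c) / (d - c) - f c) * (d - X c d) / (d - c) - (M d - M c)) / (d - c)) c := by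
  have hcm : c ∈ Ioo a b := ⟨hc, hcd.trans hd⟩
  have hpos : 0 < d - c := sub_pos.2 hcd
  have hm := hasDerivAt_slope_left hF hcd hcm
  have hnear : ∀ᶠ e in 𝓝 c, e ∈ Ioo a (X c d) := Ioo_mem_nhds hc (hX c d hc hcd hd).1.1
  have hnear' : ∀ᶠ e in 𝓝 c, a < e ∧ e < d := by
    filter_upwards [hnear] with e he using ⟨he.1, he.2.trans (hX c d hc hcd hd).1.2⟩
  have hXc : ContinuousAt (fun e => X e d) c := by
    refine hmono.continuousAt_of_comp ?_ (hm.continuousAt.congr ?_)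
    · filter_upwards [hnear'] with e he
      have := (hX e d he.1 he.2 hd).1
      exact ⟨he.1.trans this.1, this.2.trans hd⟩
    · filter_upwards [hnear'] with e he
      exact (hX e d he.1 he.2 hd).2.symm
  -- The chord is parametrised from its fixed endpoint `d`.
  have hswap : ∀ e x, e < d → (F d - F e) / (d - e) * (x - e) - (F x - F e) =
      (F d - F x) - (F d - F e) / (d - e) * (d - x) := by
    intro e x he
    have : d - e ≠ 0 := (sub_pos.2 he).ne'
    field_simp; ring
  have hK : HasDerivAt (fun e => (d - e) / 2 * (M d - M e))
      (((F d - F c) / (d - c) - f c) / (d - c) * (X c d - d)) c := by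
    refine hasDerivAt_of_envelope (Y := fun e => X e d - d) hm (hXc.sub continuousAt_const) ?_ ?_
    · filter_upwards [hnear', hnear] with e he he2
      have h1 := chord_sub_le_osc hf hF he.1 he.2 hd
        (x := X c d) ⟨he2.2.le, (hX c d hc hcd hd).1.2.le⟩
      have h2 := chord_sub_eq_osc hf hmono hF hc hcd hd
        (Ioo_subset_Icc_self (hX c d hc hcd hd).1) (hX c d hc hcd hd).2
      rw [hM e d he.1 he.2 hd, hswap _ _ he.2] at h1
      rw [hM c d hc hcd hd, hswap _ _ hcd] at h2
      linarith
    · filter_upwards [hnear', hXc.eventually (lt_mem_nhds (hX c d hc hcd hd).1.1)] with e he he3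
      have h1 := chord_sub_eq_osc hf hmono hF he.1 he.2 hd
        (Ioo_subset_Icc_self (hX e d he.1 he.2 hd).1) (hX e d he.1 he.2 hd).2
      have h2 := chord_sub_le_osc hf hF hc hcd hd
        (x := X e d) ⟨he3.le, (hX e d he.1 he.2 hd).1.2.le⟩
      rw [hM e d he.1 he.2 hd, hswap _ _ he.2] at h1
      rw [hM c d hc hcd hd, hswap _ _ hcd] at h2
      linarith
  have hdiv := ((hK.const_mul 2).div ((hasDerivAt_id c).const_sub d) hpos.ne').const_sub (M d)
  refine HasDerivAt.congr_of_eventuallyEq (hdiv.congr_deriv ?_) ?_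
  · simp only [id]; field_simp; ring
  · filter_upwards [hnear'] with e he
    have : d - e ≠ 0 := (sub_pos.2 he.2).ne'
    simp only [Pi.div_apply, id]; field_simp; ring

/-- The endpoint equation for a function `f` with primitive `F` and derivative `g`: a relation between
the values at `c` and `d` and the mean `(F d - F c) / (d - c)` of `f` over `(c, d)`, which lies strictly
between `f c` and `f d`. -/
def EndpointEquation (f F g : ℝ → ℝ) (a b : ℝ) : Prop :=
  ∀ c d, a < c → c < d → d < b →
    f c < (F d - F c) / (d - c) ∧ (F d - F c) / (d - c) < f d ∧
    (g d * (d - c) + (f d - f c)) * ((F d - F c) / (d - c) - f c) +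
      (g c * (d - c) + (f d - f c)) * (f d - (F d - F c) / (d - c)) =
      8 * (f d - (F d - F c) / (d - c)) * ((F d - F c) / (d - c) - f c)

/-- An increasing solution `f` is `C¹` with derivative `g`, four times the density of the
oscillation. The equation relating the endpoint values comes from differentiating the oscillation
in either endpoint and eliminating the point where `f` equals its mean. -/
theorem IsOscPotential.exists_hasDerivAt (hM : IsOscPotential f M a b)
    (hf : ContinuousOn f (Ioo a b)) (hmono : StrictMonoOn f (Ioo a b))
    (hF : ∀ x ∈ Ioo a b, HasDerivAt F (f x) x)
    (hvar : ∀ c d, a < c → c ≤ d → d < b → |f d - f c| ≤ 4 * (M d - M c)) :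
    ∃ g : ℝ → ℝ, ContinuousOn g (Ioo a b) ∧ (∀ x ∈ Ioo a b, HasDerivAt f (g x) x) ∧
      EndpointEquation f F g a b := by
  have hex : ∀ c d, ∃ x, a < c → c < d → d < b → x ∈ Ioo c d ∧ f x = (F d - F c) / (d - c) := by
    intro c d
    by_cases h : a < c ∧ c < d ∧ d < b
    · obtain ⟨x, hx, e⟩ := exists_hasDerivAt_eq_slope F f h.2.1
        (fun x hx => (hF x ⟨h.1.trans_le hx.1, hx.2.trans_lt h.2.2⟩).continuousAt.continuousWithinAt)
        (fun x hx => hF x ⟨h.1.trans hx.1, hx.2.trans h.2.2⟩)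
      exact ⟨x, fun _ _ _ => ⟨hx, e⟩⟩
    · exact ⟨0, fun h1 h2 h3 => absurd ⟨h1, h2, h3⟩ h⟩
  choose X hX using hex
  have hlt : ∀ c d, a < c → c < d → d < b →
      f c < (F d - F c) / (d - c) ∧ (F d - F c) / (d - c) < f d := by
    intro c d hc hcd hd
    obtain ⟨h1, h2⟩ := hX c d hc hcd hd
    rw [← h2]
    have hxm : X c d ∈ Ioo a b := ⟨hc.trans h1.1, h1.2.trans hd⟩
    exact ⟨hmono ⟨hc, hcd.trans hd⟩ hxm h1.1, hmono hxm ⟨hc.trans hcd, hd⟩ h1.2⟩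
  set N := deriv M with hN
  have hNr : ∀ c d, a < c → c < d → d < b → N d * (d - c) + (M d - M c) =
      2 * (f d - (F d - F c) / (d - c)) * (X c d - c) / (d - c) := by
    intro c d hc hcd hd
    have hpos : d - c ≠ 0 := (sub_pos.2 hcd).ne'
    rw [hN, (hM.hasDerivAt_right hf hmono hF hX hc hcd hd).2.deriv, div_mul_cancel₀ _ hpos]
    ring
  have hNl : ∀ c d, a < c → c < d → d < b → N c * (d - c) + (M d - M c) =
      2 * ((F d - F c) / (d - c) - f c) * (d - X c d) / (d - c) := by
    intro c d hc hcd hd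
    have hpos : d - c ≠ 0 := (sub_pos.2 hcd).ne'
    rw [hN, (hM.hasDerivAt_left hf hmono hF hX hc hcd hd).deriv, div_mul_cancel₀ _ hpos]
    ring
  have hMd : ∀ x ∈ Ioo a b, HasDerivAt M (N x) x := by
    intro x hx
    obtain ⟨c, hc, hcx⟩ := exists_between hx.1
    exact (hM.hasDerivAt_right hf hmono hF hX hc hcx hx.2).2.differentiableAt.hasDerivAt
  have hNc : ContinuousOn N (Ioo a b) := by
    intro d hd
    obtain ⟨c, hc, hcd⟩ := exists_between hd.1
    have hpos : d - c ≠ 0 := (sub_pos.2 hcd).ne'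
    refine ContinuousAt.continuousWithinAt ?_
    have hfd := hf.continuousAt (isOpen_Ioo.mem_nhds hd)
    have hXd := (hM.hasDerivAt_right hf hmono hF hX hc hcd hd.2).1
    have hmd := (hasDerivAt_slope_right hF hcd hd).continuousAt
    have hsd : ContinuousAt (fun e => e - c) d := by fun_prop
    have hC : ContinuousAt (fun e => (2 * (f e - (F e - F c) / (e - c)) * (X c e - c) / (e - c) -
        (M e - M c)) / (e - c)) d :=
      ((((hfd.sub hmd).const_mul 2).mul (hXd.sub continuousAt_const)).div hsd hpos |>.sub
        ((hMd d hd).continuousAt.sub continuousAt_const)).div hsd hpos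
    refine hC.congr ?_
    filter_upwards [Ioo_mem_nhds hcd hd.2] with e he
    exact (hM.hasDerivAt_right hf hmono hF hX hc he.1 he.2).2.deriv.symm
  have hrel : ∀ c d, a < c → c < d → d < b →
      (N d * (d - c) + (M d - M c)) * ((F d - F c) / (d - c) - f c) +
        (N c * (d - c) + (M d - M c)) * (f d - (F d - F c) / (d - c)) =
        2 * (f d - (F d - F c) / (d - c)) * ((F d - F c) / (d - c) - f c) := by
    intro c d hc hcd hd
    have hpos : d - c ≠ 0 := (sub_pos.2 hcd).ne'
    rw [hNr c d hc hcd hd, hNl c d hc hcd hd]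
    generalize (F d - F c) / (d - c) = m
    field_simp
    ring
  -- Two-sided bounds for the slopes of `f`: the lower one is the arithmetic-geometric mean
  -- inequality applied to `hrel`.
  have hslope : ∀ c d, a < c → c < d → d < b → 2 * (min (N c) (N d) + slope M c d) ≤ slope f c d ∧
      slope f c d ≤ 4 * slope M c d := by
    intro c d hc hcd hd
    have hpos : 0 < d - c := sub_pos.2 hcd
    obtain ⟨h1, h2⟩ := hlt c d hc hcd hd
    have h3 := hrel c d hc hcd hd
    have h4 := (abs_le.1 (hvar c d hc hcd.le hd)).2
    simp only [slope_def_field]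
    constructor
    · rw [le_div_iff₀ hpos]
      set u := f d - (F d - F c) / (d - c)
      set v := (F d - F c) / (d - c) - f c
      have hu : 0 < u := sub_pos.2 h2
      have hv : 0 < v := sub_pos.2 h1
      have huv : f d - f c = u + v := by simp only [u, v]; ring
      have e : 2 * (min (N c) (N d) + (M d - M c) / (d - c)) * (d - c) =
          2 * (min (N c) (N d) * (d - c) + (M d - M c)) := by field_simp
      rw [e, huv]
      have b1 : min (N c) (N d) * (d - c) ≤ N c * (d - c) :=
        mul_le_mul_of_nonneg_right (min_le_left _ _) hpos.le
      have b2 : min (N c) (N d) * (d - c) ≤ N d * (d - c) :=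
        mul_le_mul_of_nonneg_right (min_le_right _ _) hpos.le
      set r := min (N c) (N d) * (d - c) + (M d - M c)
      have b3 : r * v ≤ (N d * (d - c) + (M d - M c)) * v :=
        mul_le_mul_of_nonneg_right (by simp only [r]; linarith) hv.le
      have b4 : r * u ≤ (N c * (d - c) + (M d - M c)) * u :=
        mul_le_mul_of_nonneg_right (by simp only [r]; linarith) hu.le
      have b5 : (u + v) * (2 * r) ≤ (u + v) * (u + v) := by nlinarith [sq_nonneg (u - v)]
      exact le_of_mul_le_mul_left b5 (by linarith)
    · rw [← mul_div_assoc]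
      exact div_le_div_of_nonneg_right h4 hpos.le
  have hfd : ∀ x ∈ Ioo a b, HasDerivAt f (4 * N x) x := by
    intro x hx
    rw [hasDerivAt_iff_tendsto_slope]
    have hMs := hasDerivAt_iff_tendsto_slope.1 (hMd x hx)
    have hNx : Tendsto N (𝓝[≠] x) (𝓝 (N x)) :=
      (hNc.continuousAt (isOpen_Ioo.mem_nhds hx)).tendsto.mono_left nhdsWithin_le_nhds
    have hL : Tendsto (fun y => 2 * (min (N x) (N y) + slope M x y)) (𝓝[≠] x) (𝓝 (4 * N x)) := by
      have := ((tendsto_const_nhds (x := N x)).min hNx).add hMs |>.const_mul 2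
      rw [min_self] at this
      convert this using 2
      ring
    have hb : ∀ᶠ y in 𝓝[≠] x, 2 * (min (N x) (N y) + slope M x y) ≤ slope f x y ∧
        slope f x y ≤ 4 * slope M x y := by
      filter_upwards [self_mem_nhdsWithin, nhdsWithin_le_nhds (isOpen_Ioo.mem_nhds hx)] with y hne hy
      rcases lt_or_gt_of_ne hne with h | h
      · have := hslope y x hy.1 h hx.2
        rwa [slope_comm M, slope_comm f, min_comm] at this
      · exact hslope x y hx.1 h hy.2
    exact tendsto_of_tendsto_of_tendsto_of_le_of_le' hL (hMs.const_mul 4)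
      (hb.mono fun _ h => h.1) (hb.mono fun _ h => h.2)
  have hconst : ∀ c ∈ Ioo a b, ∀ d ∈ Ioo a b, f d - f c = 4 * (M d - M c) := by
    have hder : ∀ x ∈ Ioo a b, HasDerivAt (fun x => f x - 4 * M x) 0 x := fun x hx =>
      ((hfd x hx).sub ((hMd x hx).const_mul 4)).congr_deriv (by ring)
    intro c hc d hd
    have := isOpen_Ioo.is_const_of_deriv_eq_zero isPreconnected_Ioo
      (fun x hx => (hder x hx).differentiableAt.differentiableWithinAt)
      (fun x hx => (hder x hx).deriv) hc hd
    linarith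
  refine ⟨fun x => 4 * N x, hNc.const_smul (4 : ℝ), hfd, fun c d hc hcd hd => ?_⟩
  refine ⟨(hlt c d hc hcd hd).1, (hlt c d hc hcd hd).2, ?_⟩
  rw [hconst c ⟨hc, hcd.trans hd⟩ d ⟨hc.trans hcd, hd⟩]
  linear_combination 4 * hrel c d hc hcd hd

end Chord

/-! ### A conserved quantity and smoothness -/

section Conserved

variable {f F g : ℝ → ℝ} {a b : ℝ}

/-- The increment of `f` over the interval of centre `x` and half-length `t`. -/
def centralDiff (f : ℝ → ℝ) (x t : ℝ) : ℝ := f (x + t) - f (x - t)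

/-- The first moment `∫_{-t}^{t} s f'(x + s) ds`, written in terms of `f` and its primitive `F`. -/
def centralMoment (f F : ℝ → ℝ) (x t : ℝ) : ℝ :=
  t * (f (x + t) + f (x - t)) - (F (x + t) - F (x - t))

theorem hasDerivAt_comp_add {f : ℝ → ℝ} {f' x t : ℝ} (h : HasDerivAt f f' (x + t)) :
    HasDerivAt (fun s => f (x + s)) f' t := by
  simpa using h.comp_const_add x t

theorem hasDerivAt_comp_sub {f : ℝ → ℝ} {f' x t : ℝ} (h : HasDerivAt f f' (x - t)) :
    HasDerivAt (fun s => f (x - s)) (-f') t := by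
  simpa using h.comp_const_sub x t

theorem hasDerivAt_centralDiff {x t : ℝ} (hg : ∀ x ∈ Ioo a b, HasDerivAt f (g x) x)
    (h1 : x + t ∈ Ioo a b) (h2 : x - t ∈ Ioo a b) :
    HasDerivAt (centralDiff f x) (g (x + t) + g (x - t)) t :=
  ((hasDerivAt_comp_add (hg _ h1)).sub (hasDerivAt_comp_sub (hg _ h2))).congr_deriv (by ring)

theorem hasDerivAt_centralMoment {x t : ℝ} (hF : ∀ x ∈ Ioo a b, HasDerivAt F (f x) x)
    (hg : ∀ x ∈ Ioo a b, HasDerivAt f (g x) x)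
    (h1 : x + t ∈ Ioo a b) (h2 : x - t ∈ Ioo a b) :
    HasDerivAt (centralMoment f F x) (t * (g (x + t) - g (x - t))) t :=
  (((hasDerivAt_id t).mul
    ((hasDerivAt_comp_add (hg _ h1)).add (hasDerivAt_comp_sub (hg _ h2)))).sub
    ((hasDerivAt_comp_add (hF _ h1)).sub (hasDerivAt_comp_sub (hF _ h2)))).congr_deriv (by
      simp only [id, Pi.add_apply]; ring)

theorem mem_Ioo_of_lt_min {x t : ℝ} (ht : t ∈ Ioo 0 (min (x - a) (b - x))) :
    x + t ∈ Ioo a b ∧ x - t ∈ Ioo a b := by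
  have h := lt_min_iff.1 ht.2
  have h0 := ht.1
  exact ⟨⟨by linarith, by linarith⟩, ⟨by linarith, by linarith⟩⟩

/-- The endpoint equation says exactly that `(Δ / t)² - (B / t²)²` does not depend on the half-length
`t`, where `Δ` is the increment and `B` the moment; its limit as `t → 0` is `4 g(x)²`. -/
theorem EndpointEquation.conserved (hE : EndpointEquation f F g a b)
    (hF : ∀ x ∈ Ioo a b, HasDerivAt F (f x) x) (hg : ∀ x ∈ Ioo a b, HasDerivAt f (g x) x)
    (hgc : ContinuousOn g (Ioo a b)) {x t : ℝ} (hx : x ∈ Ioo a b)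
    (ht : t ∈ Ioo 0 (min (x - a) (b - x))) :
    t ^ 2 * centralDiff f x t ^ 2 - centralMoment f F x t ^ 2 = 4 * t ^ 4 * g x ^ 2 := by
  set r := min (x - a) (b - x) with hr
  have hr0 : 0 < r := lt_min (sub_pos.2 hx.1) (sub_pos.2 hx.2)
  let K : ℝ → ℝ := fun s => (centralDiff f x s / s) ^ 2 - (centralMoment f F x s / s ^ 2) ^ 2
  have hK : ∀ s ∈ Ioo 0 r, HasDerivAt K 0 s := by
    intro s hs
    obtain ⟨h1, h2⟩ := mem_Ioo_of_lt_min hs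
    have hs0 : s ≠ 0 := hs.1.ne'
    have hd := hasDerivAt_centralDiff hg h1 h2
    have hm := hasDerivAt_centralMoment hF hg h1 h2
    have hder := ((hd.div (hasDerivAt_id s) hs0).pow 2).sub
      ((hm.div (hasDerivAt_pow 2 s) (pow_ne_zero 2 hs0)).pow 2)
    refine HasDerivAt.congr_deriv hder ?_
    have e := (hE (x - s) (x + s) h2.1 (by linarith [hs.1]) h1.2).2.2
    rw [show x + s - (x - s) = 2 * s by ring] at e
    have e' : s ^ 3 * centralDiff f x s * (g (x + s) + g (x - s)) - s ^ 2 * centralDiff f x s ^ 2 -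
        s ^ 2 * centralMoment f F x s * (g (x + s) - g (x - s)) + 2 * centralMoment f F x s ^ 2
        = 0 := by
      simp only [centralDiff, centralMoment]
      field_simp at e
      linear_combination (1 / 4) * e
    simp only [Pi.div_apply, id, Nat.cast_ofNat, Nat.add_one_sub_one, pow_one, mul_one]
    field_simp
    linear_combination 2 * e'
  have hconst : ∀ s ∈ Ioo 0 r, K s = K t := by
    intro s hs
    exact isOpen_Ioo.is_const_of_deriv_eq_zero isPreconnected_Ioo
      (fun y hy => (hK y hy).differentiableAt.differentiableWithinAt)
      (fun y hy => (hK y hy).deriv) hs ht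
  have hx0 : x + 0 ∈ Ioo a b := by simpa using hx
  have hx0' : x - 0 ∈ Ioo a b := by simpa using hx
  have hdlim : Tendsto (fun s => centralDiff f x s / s) (𝓝[>] 0) (𝓝 (2 * g x)) := by
    have h := hasDerivAt_iff_tendsto_slope_zero.1 (hasDerivAt_centralDiff hg hx0 hx0')
    have h' := h.mono_left (nhdsWithin_mono (0 : ℝ) (fun y (hy : 0 < y) => hy.ne') :
      𝓝[>] (0 : ℝ) ≤ 𝓝[≠] 0)
    simp only [add_zero, sub_zero, ← two_mul] at h'
    refine h'.congr fun s => ?_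
    simp [centralDiff, div_eq_inv_mul]
  have hmlim : Tendsto (fun s => centralMoment f F x s / s ^ 2) (𝓝[>] 0) (𝓝 0) := by
    refine HasDerivAt.lhopital_zero_right_on_Ioo (f' := fun s => s * (g (x + s) - g (x - s)))
      (g' := fun s => 2 * s) hr0 (fun s hs => ?_) (fun s hs => ?_) (fun s hs => ?_) ?_ ?_ ?_
    · exact hasDerivAt_centralMoment hF hg (mem_Ioo_of_lt_min hs).1 (mem_Ioo_of_lt_min hs).2
    · simpa using hasDerivAt_pow 2 s
    · exact mul_ne_zero two_ne_zero hs.1.ne'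
    · have h := (hasDerivAt_centralMoment hF hg hx0 hx0').continuousAt.tendsto
      have e : centralMoment f F x 0 = 0 := by simp [centralMoment]
      rw [e] at h
      exact h.mono_left nhdsWithin_le_nhds
    · have h : Tendsto (fun s : ℝ => s ^ 2) (𝓝 0) (𝓝 (0 ^ 2)) := (continuous_pow 2).tendsto 0
      rw [zero_pow two_ne_zero] at h
      exact h.mono_left nhdsWithin_le_nhds
    · have hgx := hgc.continuousAt (isOpen_Ioo.mem_nhds hx)
      have h1 : Tendsto (fun s => g (x + s)) (𝓝 0) (𝓝 (g x)) :=
        hgx.tendsto.comp (by simpa using (tendsto_id (x := 𝓝 (0 : ℝ))).const_add x)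
      have h2 : Tendsto (fun s => g (x - s)) (𝓝 0) (𝓝 (g x)) :=
        hgx.tendsto.comp (by simpa using (tendsto_id (x := 𝓝 (0 : ℝ))).const_sub x)
      have h3 := ((h1.sub h2).div_const 2).mono_left (nhdsWithin_le_nhds (s := Ioi 0))
      rw [sub_self, zero_div] at h3
      refine h3.congr' ?_
      filter_upwards [self_mem_nhdsWithin] with s hs
      have : s ≠ 0 := (mem_Ioi.1 hs).ne'
      field_simp
  have hlim : Tendsto K (𝓝[>] 0) (𝓝 ((2 * g x) ^ 2 - 0 ^ 2)) := (hdlim.pow 2).sub (hmlim.pow 2)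
  have hKt : K t = 4 * g x ^ 2 := by
    have hc : Tendsto K (𝓝[>] 0) (𝓝 (K t)) := by
      refine tendsto_const_nhds.congr' ?_
      filter_upwards [Ioo_mem_nhdsGT hr0] with s hs using (hconst s hs).symm
    rw [tendsto_nhds_unique hc hlim]; ring
  have ht0 : t ≠ 0 := ht.1.ne'
  simp only [K] at hKt
  field_simp at hKt
  linear_combination hKt

theorem EndpointEquation.deriv_pos (hE : EndpointEquation f F g a b)
    (hF : ∀ x ∈ Ioo a b, HasDerivAt F (f x) x) (hg : ∀ x ∈ Ioo a b, HasDerivAt f (g x) x)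
    (hgc : ContinuousOn g (Ioo a b)) (hmono : StrictMonoOn f (Ioo a b)) {x : ℝ}
    (hx : x ∈ Ioo a b) : 0 < g x := by
  obtain ⟨t, ht⟩ : (Ioo 0 (min (x - a) (b - x))).Nonempty :=
    nonempty_Ioo.2 (lt_min (sub_pos.2 hx.1) (sub_pos.2 hx.2))
  have hnonneg : 0 ≤ g x := by
    have h := (hasDerivAt_iff_tendsto_slope.1 (hg x hx)).mono_left
      (nhdsWithin_mono x (fun y (hy : x < y) => hy.ne') : 𝓝[>] x ≤ 𝓝[≠] x)
    refine ge_of_tendsto h ?_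
    filter_upwards [Ioo_mem_nhdsGT hx.2] with y hy
    rw [slope_def_field]
    exact div_nonneg (sub_nonneg.2 (hmono hx ⟨hx.1.trans hy.1, hy.2⟩ hy.1).le)
      (sub_nonneg.2 hy.1.le)
  have hcons := hE.conserved hF hg hgc hx ht
  obtain ⟨h1, h2⟩ := mem_Ioo_of_lt_min ht
  have ht0 := ht.1
  obtain ⟨hl, hu, -⟩ := hE (x - t) (x + t) h2.1 (by linarith) h1.2
  rw [show x + t - (x - t) = 2 * t by ring] at hl hu
  rw [lt_div_iff₀ (by linarith)] at hl
  rw [div_lt_iff₀ (by linarith)] at hu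
  have hpos : 0 < t ^ 2 * centralDiff f x t ^ 2 - centralMoment f F x t ^ 2 := by
    have := mul_pos (sub_pos.2 hl) (sub_pos.2 hu)
    simp only [centralDiff, centralMoment]
    nlinarith
  refine lt_of_le_of_ne hnonneg fun h0 => ?_
  rw [hcons, ← h0] at hpos
  simp at hpos

/-- Solving the conservation law for `g` at a fixed half-length shows that `g` is as smooth as `f`;
since `g` is the derivative of `f`, both are smooth. -/
theorem EndpointEquation.contDiffOn (hE : EndpointEquation f F g a b)
    (hF : ∀ x ∈ Ioo a b, HasDerivAt F (f x) x) (hg : ∀ x ∈ Ioo a b, HasDerivAt f (g x) x)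
    (hgc : ContinuousOn g (Ioo a b)) (hmono : StrictMonoOn f (Ioo a b)) :
    ContDiffOn ℝ ∞ g (Ioo a b) := by
  have step : ∀ n : ℕ, ContDiffOn ℝ n f (Ioo a b) → ContDiffOn ℝ n g (Ioo a b) := by
    intro n hfn
    have hFn : ContDiffOn ℝ n F (Ioo a b) := by
      have : ContDiffOn ℝ (n + 1) F (Ioo a b) := by
        rw [contDiffOn_succ_iff_deriv_of_isOpen isOpen_Ioo]
        refine ⟨fun x hx => (hF x hx).differentiableAt.differentiableWithinAt,
          fun h => absurd h (by simp), hfn.congr fun x hx => (hF x hx).deriv⟩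
      exact this.of_le (by exact_mod_cast Nat.le_succ n)
    intro x hx
    obtain ⟨t, ht⟩ : (Ioo 0 (min (x - a) (b - x))).Nonempty :=
      nonempty_Ioo.2 (lt_min (sub_pos.2 hx.1) (sub_pos.2 hx.2))
    obtain ⟨h1, h2⟩ := mem_Ioo_of_lt_min ht
    have ht0 : t ≠ 0 := ht.1.ne'
    have f1 := hfn.contDiffAt (isOpen_Ioo.mem_nhds h1)
    have f2 := hfn.contDiffAt (isOpen_Ioo.mem_nhds h2)
    have F1 := hFn.contDiffAt (isOpen_Ioo.mem_nhds h1)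
    have F2 := hFn.contDiffAt (isOpen_Ioo.mem_nhds h2)
    let G : ℝ → ℝ := fun y =>
      (t ^ 2 * centralDiff f y t ^ 2 - centralMoment f F y t ^ 2) / (4 * t ^ 4)
    have hG : ∀ᶠ y in 𝓝 x, y ∈ Ioo a b ∧ G y = g y ^ 2 := by
      have hnear : ∀ᶠ y in 𝓝 x, t < min (y - a) (b - y) := by
        have hc : ContinuousAt (fun y : ℝ => min (y - a) (b - y)) x := by fun_prop
        exact hc.eventually (lt_mem_nhds ht.2)
      filter_upwards [hnear, isOpen_Ioo.mem_nhds hx] with y hy hym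
      refine ⟨hym, ?_⟩
      simp only [G]
      rw [hE.conserved hF hg hgc hym ⟨ht.1, hy⟩]
      field_simp
    have hGn : ContDiffAt ℝ n G x := by
      simp only [G, centralDiff, centralMoment]
      fun_prop
    have hGx : G x ≠ 0 := by
      rw [hG.self_of_nhds.2]
      exact pow_ne_zero 2 (hE.deriv_pos hF hg hgc hmono hx).ne'
    refine ((hGn.sqrt hGx).congr_of_eventuallyEq ?_).contDiffWithinAt
    filter_upwards [hG] with y hy
    rw [hy.2, Real.sqrt_sq (hE.deriv_pos hF hg hgc hmono hy.1).le]
  have hfn : ∀ n : ℕ, ContDiffOn ℝ n f (Ioo a b) := by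
    intro n
    induction n with
    | zero =>
      exact contDiffOn_zero.2 fun x hx => (hg x hx).continuousAt.continuousWithinAt
    | succ n ih =>
      push_cast
      rw [contDiffOn_succ_iff_deriv_of_isOpen isOpen_Ioo]
      exact ⟨fun x hx => (hg x hx).differentiableAt.differentiableWithinAt,
        fun h => absurd h (by simp), (step n ih).congr fun x hx => (hg x hx).deriv⟩
  exact contDiffOn_infty.2 fun n => step n (hfn n)

end Conserved

/-! ### Asymptotic expansion of the conserved quantity -/

theorem isBigO_pow_succ_of_hasDerivAt {φ φ' : ℝ → ℝ} {n : ℕ}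
    (h : ∀ᶠ t in 𝓝 0, HasDerivAt φ (φ' t) t) (h0 : φ 0 = 0)
    (hO : φ' =O[𝓝 0] fun t => t ^ n) : φ =O[𝓝 0] fun t => t ^ (n + 1) := by
  obtain ⟨C, hC⟩ := hO.bound
  obtain ⟨ε, hε, hball⟩ := Metric.eventually_nhds_iff.1 (h.and hC)
  refine Asymptotics.IsBigO.of_bound C ?_
  filter_upwards [Metric.ball_mem_nhds 0 hε] with t ht
  rw [mem_ball_zero_iff] at ht
  have hmem : ∀ s ∈ Icc (-|t|) |t|, dist s 0 < ε := fun s hs => by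
    rw [Real.dist_eq, sub_zero]; exact (abs_le.2 hs).trans_lt ht
  have hC0 : t ≠ 0 → 0 ≤ C := fun ht0 => by
    have := (norm_nonneg _).trans (hball (hmem t (abs_le.1 le_rfl))).2
    exact nonneg_of_mul_nonneg_left this (norm_pos_iff.2 (pow_ne_zero n ht0))
  rcases eq_or_ne t 0 with rfl | ht0
  · simp [h0]
  have key := Convex.norm_image_sub_le_of_norm_hasDerivWithin_le (f := φ) (f' := φ')
    (s := Icc (-|t|) |t|) (C := C * |t| ^ n) (x := 0) (y := t)
    (fun s hs => (hball (hmem s hs)).1.hasDerivWithinAt)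
    (fun s hs => (hball (hmem s hs)).2.trans (by
      rw [norm_pow, Real.norm_eq_abs]
      exact mul_le_mul_of_nonneg_left (pow_le_pow_left₀ (abs_nonneg _) (abs_le.2 hs) n) (hC0 ht0)))
    (convex_Icc _ _) (by simp) (abs_le.1 le_rfl)
  rw [h0, sub_zero, sub_zero, Real.norm_eq_abs t] at key
  rw [norm_pow, Real.norm_eq_abs t, pow_succ, ← mul_assoc]
  exact key

/-- Taylor expansion to fourth order of a function with derivatives `g₁, …, g₅`. -/
theorem isBigO_taylor_four {g g₁ g₂ g₃ g₄ g₅ : ℝ → ℝ} {a b x : ℝ} (hx : x ∈ Ioo a b)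
    (h1 : ∀ x ∈ Ioo a b, HasDerivAt g (g₁ x) x) (h2 : ∀ x ∈ Ioo a b, HasDerivAt g₁ (g₂ x) x)
    (h3 : ∀ x ∈ Ioo a b, HasDerivAt g₂ (g₃ x) x) (h4 : ∀ x ∈ Ioo a b, HasDerivAt g₃ (g₄ x) x)
    (h5 : ∀ x ∈ Ioo a b, HasDerivAt g₄ (g₅ x) x) :
    (fun t => g (x + t) - (g x + g₁ x * t + g₂ x * t ^ 2 / 2 + g₃ x * t ^ 3 / 6 +
      g₄ x * t ^ 4 / 24)) =O[𝓝 0] fun t => t ^ 5 := by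
  have hnear : ∀ᶠ t in 𝓝 (0 : ℝ), x + t ∈ Ioo a b := by
    have hc : ContinuousAt (fun t => x + t) (0 : ℝ) := by fun_prop
    exact hc.eventually (isOpen_Ioo.mem_nhds (by simpa using hx))
  have e4 : (fun t => g₄ (x + t) - g₄ x) =O[𝓝 0] fun t => t ^ 1 := by
    have := (hasDerivAt_comp_add (t := 0) (h5 (x + 0) (by simpa using hx))).isBigO_sub
    simpa using this
  have e3 : (fun t => g₃ (x + t) - (g₃ x + g₄ x * t)) =O[𝓝 0] fun t => t ^ 2 := by
    refine isBigO_pow_succ_of_hasDerivAt (hnear.mono fun t ht => ?_) (by simp) e4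
    refine ((hasDerivAt_comp_add (h4 _ ht)).sub
      (((hasDerivAt_id t).const_mul (g₄ x)).const_add (g₃ x))).congr_deriv ?_
    ring
  have e2 : (fun t => g₂ (x + t) - (g₂ x + g₃ x * t + g₄ x * t ^ 2 / 2)) =O[𝓝 0]
      fun t => t ^ 3 := by
    refine isBigO_pow_succ_of_hasDerivAt (hnear.mono fun t ht => ?_) (by simp) e3
    refine ((hasDerivAt_comp_add (h3 _ ht)).sub
      ((((hasDerivAt_id t).const_mul (g₃ x)).const_add (g₂ x)).add
        (((hasDerivAt_pow 2 t).const_mul (g₄ x)).div_const 2))).congr_deriv ?_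
    norm_num; ring
  have e1 : (fun t => g₁ (x + t) - (g₁ x + g₂ x * t + g₃ x * t ^ 2 / 2 + g₄ x * t ^ 3 / 6))
      =O[𝓝 0] fun t => t ^ 4 := by
    refine isBigO_pow_succ_of_hasDerivAt (hnear.mono fun t ht => ?_) (by simp) e2
    refine ((hasDerivAt_comp_add (h2 _ ht)).sub
      (((((hasDerivAt_id t).const_mul (g₂ x)).const_add (g₁ x)).add
        (((hasDerivAt_pow 2 t).const_mul (g₃ x)).div_const 2)).add
        (((hasDerivAt_pow 3 t).const_mul (g₄ x)).div_const 6))).congr_deriv ?_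
    norm_num; ring
  refine isBigO_pow_succ_of_hasDerivAt (hnear.mono fun t ht => ?_) (by simp) e1
  refine ((hasDerivAt_comp_add (h1 _ ht)).sub
    ((((((hasDerivAt_id t).const_mul (g₁ x)).const_add (g x)).add
      (((hasDerivAt_pow 2 t).const_mul (g₂ x)).div_const 2)).add
      (((hasDerivAt_pow 3 t).const_mul (g₃ x)).div_const 6)).add
      (((hasDerivAt_pow 4 t).const_mul (g₄ x)).div_const 24))).congr_deriv ?_
  norm_num; ring

theorem coeff_eq_zero_of_isBigO {α β γ δ : ℝ}
    (h : (fun t : ℝ => α * t ^ 6 + β * t ^ 8 + γ * t ^ 10 + δ * t ^ 12) =O[𝓝[>] 0]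
      fun t => t ^ 9) : α = 0 ∧ β = 0 := by
  obtain ⟨C, hC⟩ := h.bound
  have hpow : ∀ n : ℕ, n ≠ 0 → Tendsto (fun t : ℝ => t ^ n) (𝓝[>] 0) (𝓝 0) := fun n hn => by
    have := ((continuous_pow n).tendsto (0 : ℝ)).mono_left (nhdsWithin_le_nhds (s := Ioi 0))
    rwa [zero_pow hn] at this
  have hα : α = 0 := by
    have h1 : ∀ᶠ t : ℝ in 𝓝[>] 0,
        ‖α + β * t ^ 2 + γ * t ^ 4 + δ * t ^ 6‖ ≤ C * t ^ 3 := by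
      filter_upwards [hC, self_mem_nhdsWithin] with t ht ht0
      have ht0' : 0 < t := ht0
      have e : α * t ^ 6 + β * t ^ 8 + γ * t ^ 10 + δ * t ^ 12 =
          t ^ 6 * (α + β * t ^ 2 + γ * t ^ 4 + δ * t ^ 6) := by ring
      have p6 : 0 < t ^ 6 := by positivity
      rw [e, norm_mul, Real.norm_of_nonneg p6.le, Real.norm_of_nonneg (by positivity : 0 ≤ t ^ 9),
        show C * t ^ 9 = t ^ 6 * (C * t ^ 3) by ring] at ht
      exact le_of_mul_le_mul_left ht p6
    have h2 := (((hpow 2 two_ne_zero).const_mul β).const_add α).add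
      ((hpow 4 four_ne_zero).const_mul γ) |>.add ((hpow 6 (by norm_num)).const_mul δ)
    have h3 := squeeze_zero_norm' h1 (by simpa using (hpow 3 three_ne_zero).const_mul C)
    simpa using tendsto_nhds_unique h2 h3
  refine ⟨hα, ?_⟩
  have h1 : ∀ᶠ t : ℝ in 𝓝[>] 0, ‖β + γ * t ^ 2 + δ * t ^ 4‖ ≤ C * t ^ 1 := by
    filter_upwards [hC, self_mem_nhdsWithin] with t ht ht0
    have ht0' : 0 < t := ht0
    have e : α * t ^ 6 + β * t ^ 8 + γ * t ^ 10 + δ * t ^ 12 =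
        t ^ 8 * (β + γ * t ^ 2 + δ * t ^ 4) := by rw [hα]; ring
    have p8 : 0 < t ^ 8 := by positivity
    rw [e, norm_mul, Real.norm_of_nonneg p8.le, Real.norm_of_nonneg (by positivity : 0 ≤ t ^ 9),
      show C * t ^ 9 = t ^ 8 * (C * t ^ 1) by ring] at ht
    exact le_of_mul_le_mul_left ht p8
  have h2 := (((hpow 2 two_ne_zero).const_mul γ).const_add β).add
    ((hpow 4 four_ne_zero).const_mul δ)
  have h3 := squeeze_zero_norm' h1 (by simpa using (hpow 1 one_ne_zero).const_mul C)
  simpa using tendsto_nhds_unique h2 h3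

/-- Comparing the coefficients of `t ^ 6` and `t ^ 8` in the conservation law. -/
theorem EndpointEquation.coeff_relations {f F g g₁ g₂ g₃ g₄ g₅ : ℝ → ℝ} {a b x : ℝ}
    (hE : EndpointEquation f F g a b)
    (hF : ∀ x ∈ Ioo a b, HasDerivAt F (f x) x) (hg : ∀ x ∈ Ioo a b, HasDerivAt f (g x) x)
    (hx : x ∈ Ioo a b)
    (h1 : ∀ x ∈ Ioo a b, HasDerivAt g (g₁ x) x) (h2 : ∀ x ∈ Ioo a b, HasDerivAt g₁ (g₂ x) x)
    (h3 : ∀ x ∈ Ioo a b, HasDerivAt g₂ (g₃ x) x) (h4 : ∀ x ∈ Ioo a b, HasDerivAt g₃ (g₄ x) x)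
    (h5 : ∀ x ∈ Ioo a b, HasDerivAt g₄ (g₅ x) x) :
    3 * g x * g₂ x = g₁ x ^ 2 ∧ 5 * g₂ x ^ 2 + 3 * g x * g₄ x = 4 * g₁ x * g₃ x := by
  have hgc : ContinuousOn g (Ioo a b) := fun y hy => (h1 y hy).continuousAt.continuousWithinAt
  have hr0 : 0 < min (x - a) (b - x) := lt_min (sub_pos.2 hx.1) (sub_pos.2 hx.2)
  have hnear : ∀ᶠ t in 𝓝 (0 : ℝ), x + t ∈ Ioo a b ∧ x - t ∈ Ioo a b := by
    have hc : ContinuousAt (fun t => x + t) (0 : ℝ) := by fun_prop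
    have hc' : ContinuousAt (fun t => x - t) (0 : ℝ) := by fun_prop
    exact (hc.eventually (isOpen_Ioo.mem_nhds (by simpa using hx))).and
      (hc'.eventually (isOpen_Ioo.mem_nhds (by simpa using hx)))
  have hp := isBigO_taylor_four hx h1 h2 h3 h4 h5
  have hm : (fun t => g (x - t) - (g x - g₁ x * t + g₂ x * t ^ 2 / 2 - g₃ x * t ^ 3 / 6 +
      g₄ x * t ^ 4 / 24)) =O[𝓝 0] fun t => t ^ 5 := by
    have hneg : Tendsto (fun t : ℝ => -t) (𝓝 0) (𝓝 0) := by simpa using (continuous_neg.tendsto (0 : ℝ))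
    have h := (hp.comp_tendsto hneg)
    have h' : ((fun t : ℝ => t ^ 5) ∘ fun t : ℝ => -t) = fun t => -t ^ 5 := by
      ext t; simp only [Function.comp]; ring
    rw [h', Asymptotics.isBigO_neg_right] at h
    refine h.congr_left fun t => ?_
    simp only [Function.comp]; ring_nf
  let p : ℝ → ℝ := fun t => 2 * g x * t + g₂ x * t ^ 3 / 3 + g₄ x * t ^ 5 / 60
  let q : ℝ → ℝ := fun t => 2 * g₁ x * t ^ 3 / 3 + g₃ x * t ^ 5 / 15
  have hΔ : (fun t => centralDiff f x t - p t) =O[𝓝 0] fun t => t ^ 6 := by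
    refine isBigO_pow_succ_of_hasDerivAt
      (φ' := fun t => (g (x + t) + g (x - t)) - (2 * g x + g₂ x * t ^ 2 + g₄ x * t ^ 4 / 12))
      (hnear.mono fun t ht => ?_) (by simp [centralDiff, p]) ?_
    · refine ((hasDerivAt_centralDiff hg ht.1 ht.2).sub
        ((((hasDerivAt_id t).const_mul (2 * g x)).add
          (((hasDerivAt_pow 3 t).const_mul (g₂ x)).div_const 3)).add
          (((hasDerivAt_pow 5 t).const_mul (g₄ x)).div_const 60))).congr_deriv ?_
      norm_num; ring
    · refine (hp.add hm).congr_left fun t => ?_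
      ring
  have hB : (fun t => centralMoment f F x t - q t) =O[𝓝 0] fun t => t ^ 7 := by
    refine isBigO_pow_succ_of_hasDerivAt
      (φ' := fun t => t * (g (x + t) - g (x - t)) - (2 * g₁ x * t ^ 2 + g₃ x * t ^ 4 / 3))
      (hnear.mono fun t ht => ?_) (by simp [centralMoment, q]) ?_
    · refine ((hasDerivAt_centralMoment hF hg ht.1 ht.2).sub
        ((((hasDerivAt_pow 3 t).const_mul (2 * g₁ x)).div_const 3).add
          (((hasDerivAt_pow 5 t).const_mul (g₃ x)).div_const 15))).congr_deriv ?_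
      norm_num; ring
    · have := (Asymptotics.isBigO_refl (fun t : ℝ => t) (𝓝 0)).mul (hp.sub hm)
      refine this.congr (fun t => ?_) fun t => ?_ <;> ring
  have hpow : ∀ {m n : ℕ}, m ≤ n → (fun t : ℝ => t ^ n) =O[𝓝 0] fun t => t ^ m := by
    intro m n hmn
    rcases hmn.eq_or_lt with rfl | h
    · exact Asymptotics.isBigO_refl _ _
    · exact (Asymptotics.isLittleO_pow_pow h).isBigO
  have hp1 : p =O[𝓝 0] fun t => t ^ 1 := by
    refine (((hpow le_rfl).const_mul_left (2 * g x)).add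
      ((hpow (by norm_num : 1 ≤ 3)).const_mul_left (g₂ x / 3)) |>.add
      ((hpow (by norm_num : 1 ≤ 5)).const_mul_left (g₄ x / 60))).congr_left fun t => ?_
    simp only [p]; ring
  have hq2 : q =O[𝓝 0] fun t => t ^ 2 := by
    refine (((hpow (by norm_num : 2 ≤ 3)).const_mul_left (2 * g₁ x / 3)).add
      ((hpow (by norm_num : 2 ≤ 5)).const_mul_left (g₃ x / 15))).congr_left fun t => ?_
    simp only [q]; ring
  have hΔ1 := hΔ.mul (((hΔ.trans (hpow (by norm_num : 1 ≤ 6))).add (hp1.const_mul_left 2)))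
  have hB2 := hB.mul (((hB.trans (hpow (by norm_num : 2 ≤ 7))).add (hq2.const_mul_left 2)))
  have hΔ2 := (Asymptotics.isBigO_refl (fun t : ℝ => t ^ 2) (𝓝 0)).mul hΔ1
  have hsum := ((hB2.congr_right fun t => (by ring : t ^ 7 * t ^ 2 = t ^ 9)).sub
    (hΔ2.congr_right fun t => (by ring : t ^ 2 * (t ^ 6 * t ^ 1) = t ^ 9))).mono
    (nhdsWithin_le_nhds (s := Ioi 0))
  have hfin := coeff_eq_zero_of_isBigO (α := 4 * g x * g₂ x / 3 - 4 * g₁ x ^ 2 / 9)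
    (β := g₂ x ^ 2 / 9 + g x * g₄ x / 15 - 4 * g₁ x * g₃ x / 45)
    (γ := g₂ x * g₄ x / 90 - g₃ x ^ 2 / 225) (δ := g₄ x ^ 2 / 3600) (by
      refine hsum.congr' ?_ EventuallyEq.rfl
      filter_upwards [Ioo_mem_nhdsGT hr0] with t ht
      have hcons := hE.conserved hF hg hgc hx ht
      simp only [p, q]
      linear_combination -hcons)
  exact ⟨by linarith [hfin.1], by linarith [hfin.2]⟩

/-- Differentiating the first relation twice and comparing with the second leaves `g' = 0`. -/
theorem EndpointEquation.hasDerivAt_zero {f F g : ℝ → ℝ} {a b : ℝ} (hE : EndpointEquation f F g a b)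
    (hF : ∀ x ∈ Ioo a b, HasDerivAt F (f x) x) (hg : ∀ x ∈ Ioo a b, HasDerivAt f (g x) x)
    (hgc : ContinuousOn g (Ioo a b)) (hmono : StrictMonoOn f (Ioo a b)) :
    ∀ x ∈ Ioo a b, HasDerivAt g 0 x := by
  have hs : ∀ {k : ℝ → ℝ}, ContDiffOn ℝ ∞ k (Ioo a b) →
      ContDiffOn ℝ ∞ (deriv k) (Ioo a b) ∧ ∀ x ∈ Ioo a b, HasDerivAt k (deriv k x) x := by
    intro k hk
    have := (contDiffOn_infty_iff_deriv_of_isOpen isOpen_Ioo).1 hk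
    exact ⟨this.2, fun x hx => (this.1.differentiableAt (isOpen_Ioo.mem_nhds hx)).hasDerivAt⟩
  obtain ⟨s1, h1⟩ := hs (hE.contDiffOn hF hg hgc hmono)
  obtain ⟨s2, h2⟩ := hs s1
  obtain ⟨s3, h3⟩ := hs s2
  obtain ⟨s4, h4⟩ := hs s3
  obtain ⟨-, h5⟩ := hs s4
  set g₁ := deriv g
  set g₂ := deriv g₁
  set g₃ := deriv g₂
  set g₄ := deriv g₃
  have hrel := fun x hx => hE.coeff_relations hF hg (x := x) hx h1 h2 h3 h4 h5
  have hzero : ∀ {k : ℝ → ℝ} {k' x : ℝ}, (∀ y ∈ Ioo a b, k y = 0) → x ∈ Ioo a b →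
      HasDerivAt k k' x → k' = 0 := by
    intro k k' x hk hx hd
    have h0 : HasDerivAt k 0 x := (hasDerivAt_const x (0 : ℝ)).congr_of_eventuallyEq
      (by filter_upwards [isOpen_Ioo.mem_nhds hx] with y hy using hk y hy)
    exact hd.unique h0
  have d1 : ∀ x ∈ Ioo a b, g₁ x * g₂ x + 3 * (g x * g₃ x) = 0 := by
    intro x hx
    have := hzero (k := fun y => 3 * (g y * g₂ y) - g₁ y ^ 2)
      (fun y hy => by linarith [(hrel y hy).1]) hx
      ((((h1 x hx).mul (h3 x hx)).const_mul 3).sub ((h2 x hx).pow 2))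
    norm_num at this
    linarith
  have d2 : ∀ x ∈ Ioo a b, g₂ x ^ 2 + 4 * (g₁ x * g₃ x) + 3 * (g x * g₄ x) = 0 := by
    intro x hx
    have := hzero (k := fun y => g₁ y * g₂ y + 3 * (g y * g₃ y)) d1 hx
      (((h2 x hx).mul (h3 x hx)).add (((h1 x hx).mul (h4 x hx)).const_mul 3))
    linarith
  intro x hx
  have hpos := hE.deriv_pos hF hg hgc hmono hx
  obtain ⟨r1, r2⟩ := hrel x hx
  have e1 : g₂ x ^ 2 = 2 * (g₁ x * g₃ x) := by linarith [d2 x hx]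
  have e2 : g x * g₂ x ^ 2 = 0 := by
    linear_combination (1 / 3) * g x * e1 + (2 / 9) * g₁ x * d1 x hx + (2 / 9) * g₂ x * r1
  have e3 : g₂ x = 0 := by
    rcases mul_eq_zero.1 e2 with h | h
    · exact absurd h hpos.ne'
    · exact pow_eq_zero_iff two_ne_zero |>.1 h
  have e4 : g₁ x = 0 := by
    rw [e3, mul_zero] at r1
    exact pow_eq_zero_iff two_ne_zero |>.1 r1.symm
  exact (h1 x hx).congr_deriv e4

/-! ### Solutions are affine -/

theorem IsOscPotential.exists_affine_of_strictMonoOn {f M : ℝ → ℝ} {a b : ℝ} (hab : a < b)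
    (hM : IsOscPotential f M a b) (hf : ContinuousOn f (Ioo a b)) (hmono : StrictMonoOn f (Ioo a b))
    (hvar : ∀ c d, a < c → c ≤ d → d < b → |f d - f c| ≤ 4 * (M d - M c)) :
    ∃ p q : ℝ, ∀ x ∈ Ioo a b, f x = p * x + q := by
  obtain ⟨x₀, hx₀⟩ := exists_between hab
  have hx₀m : x₀ ∈ Ioo a b := hx₀
  have hF : ∀ x ∈ Ioo a b, HasDerivAt (fun y => ∫ t in x₀..y, f t) (f x) x := fun x hx =>
    intervalIntegral.integral_hasDerivAt_right
      (hf.mono (ordConnected_Ioo.uIcc_subset hx₀m hx)).intervalIntegrable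
      (hf.stronglyMeasurableAtFilter isOpen_Ioo x hx) (hf.continuousAt (isOpen_Ioo.mem_nhds hx))
  obtain ⟨g, hgc, hg, hE⟩ := hM.exists_hasDerivAt hf hmono hF hvar
  have hg0 := hE.hasDerivAt_zero hF hg hgc hmono
  have hgconst : ∀ x ∈ Ioo a b, g x = g x₀ := fun x hx =>
    isOpen_Ioo.is_const_of_deriv_eq_zero isPreconnected_Ioo
      (fun y hy => (hg0 y hy).differentiableAt.differentiableWithinAt)
      (fun y hy => (hg0 y hy).deriv) hx hx₀m
  have hder : ∀ x ∈ Ioo a b, HasDerivAt (fun x => f x - g x₀ * x) 0 x := fun x hx => by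
    refine ((hg x hx).sub ((hasDerivAt_id x).const_mul (g x₀))).congr_deriv ?_
    rw [hgconst x hx, mul_one, sub_self]
  refine ⟨g x₀, f x₀ - g x₀ * x₀, fun x hx => ?_⟩
  have : f x - g x₀ * x = f x₀ - g x₀ * x₀ :=
    isOpen_Ioo.is_const_of_deriv_eq_zero isPreconnected_Ioo
      (fun y hy => (hder y hy).differentiableAt.differentiableWithinAt)
      (fun y hy => (hder y hy).deriv) hx hx₀m
  linarith

theorem IsOscPotential.exists_affine {f M : ℝ → ℝ} {a b : ℝ} (hab : a < b)
    (hM : IsOscPotential f M a b) (hf : ContinuousOn f (Ioo a b))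
    (hvar : ∀ c d, a < c → c ≤ d → d < b → |f d - f c| ≤ 4 * (M d - M c)) :
    ∃ p q : ℝ, ∀ x ∈ Ioo a b, f x = p * x + q := by
  rcases hM.const_or_strictMono_or_strictAnti hab hf hvar with ⟨k, hk⟩ | hmono | hanti
  · exact ⟨0, k, fun x hx => by rw [hk x hx]; ring⟩
  · exact hM.exists_affine_of_strictMonoOn hab hf hmono hvar
  · have hM' : IsOscPotential (fun x => -f x) M a b := fun c d hc hcd hd => by
      rw [osc_neg]; exact hM c d hc hcd hd
    obtain ⟨p, q, h⟩ := hM'.exists_affine_of_strictMonoOn hab hf.neg hanti.neg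
      (fun c d hc hcd hd => by
        rw [show -f d - -f c = -(f d - f c) by ring, abs_neg]; exact hvar c d hc hcd hd)
    exact ⟨-p, -q, fun x hx => by linarith [h x hx]⟩

theorem exists_ae_eq_affine {f : ℝ → ℝ} {a b : ℝ} (hab : a < b)
    (hf : LocallyIntegrableOn f (Ioo a b) volume) {μ : Measure (Ioo a b)}
    (hμ : ∀ c d : ℝ, a < c → c < d → d < b →
      μ (Subtype.val ⁻¹' Ioo c d) = ENNReal.ofReal (osc f c d)) :
    ∃ p q : ℝ, ∀ᵐ x ∂(volume.restrict (Ioo a b)), f x = p * x + q := by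
  obtain ⟨M, hMc, hM⟩ := exists_isOscPotential hab hf fun c d e hc hcd hde he =>
    osc_add_osc_of_measure hf hμ hc hcd hde he
  obtain ⟨g, hgc, hfg, hvar⟩ := hM.exists_continuousOn_ae_eq hab hf hMc
  have hMg : IsOscPotential g M a b := fun c d hc hcd hd => by
    rw [← hM c d hc hcd hd]
    exact (osc_congr_ae (ae_restrict_of_ae_restrict_of_subset
      (Ioo_subset_Ioo hc.le hd.le) hfg)).symm
  obtain ⟨p, q, h⟩ := hMg.exists_affine hab hgc fun c d hc hcd hd => by
    have hc' : c ∈ Ioo a b := ⟨hc, hcd.trans_lt hd⟩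
    have hd' : d ∈ Ioo a b := ⟨hc.trans_le hcd, hd⟩
    rw [← abs_of_nonneg (sub_nonneg.2 (hM.mono hc' hd' hcd))]
    exact hvar c hc' d hd'
  refine ⟨p, q, ?_⟩
  filter_upwards [hfg, ae_restrict_mem measurableSet_Ioo] with x hx hxm
  rw [hx, h x hxm]

/-! ### Oscillation and variation of affine functions -/

theorem osc_affine (p q : ℝ) {c d : ℝ} (hcd : c < d) :
    osc (fun x => p * x + q) c d = |p| / 4 * (d - c) := by
  have hid : osc (fun x => x) c d = (d - c) / 4 := by
    have h := chord_sub_eq_osc (f := fun x => x) (F := fun x => x ^ 2 / 2) (a := c - 1) (b := d + 1)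
      (c := c) (d := d) (x := (c + d) / 2) continuousOn_id (fun x _ y _ h => h)
      (fun x _ => by simpa using (hasDerivAt_pow 2 x).div_const 2) (by linarith) hcd (by linarith)
      ⟨by linarith, by linarith⟩ (by
        have : d - c ≠ 0 := (sub_pos.2 hcd).ne'
        field_simp; ring)
    have hpos : d - c ≠ 0 := (sub_pos.2 hcd).ne'
    have e : (d ^ 2 / 2 - c ^ 2 / 2) / (d - c) = (d + c) / 2 := by field_simp; ring
    simp only [e] at h
    have h2 : (d - c) / 2 * osc (fun x => x) c d = (d - c) / 2 * ((d - c) / 4) := by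
      rw [← h]; ring
    exact mul_left_cancel₀ (div_ne_zero hpos two_ne_zero) h2
  have hm : meanValue (fun x => p * x + q) c d = p * meanValue (fun x => x) c d + q := by
    have hpos : d - c ≠ 0 := (sub_pos.2 hcd).ne'
    rw [meanValue_eq_intervalIntegral _ hcd.le, meanValue_eq_intervalIntegral _ hcd.le,
      intervalIntegral.integral_add (Continuous.intervalIntegrable (by fun_prop) _ _)
        intervalIntegrable_const, intervalIntegral.integral_const_mul,
      intervalIntegral.integral_const, smul_eq_mul]
    field_simp
  have hint : ∀ x, |p * x + q - meanValue (fun x => p * x + q) c d| =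
      |p| * |x - meanValue (fun x => x) c d| := fun x => by
    rw [hm, ← abs_mul]; congr 1; ring
  have h : osc (fun x => p * x + q) c d = |p| * osc (fun x => x) c d := by
    rw [osc, osc]
    simp only [hint]
    rw [integral_const_mul]
    ring
  rw [h, hid]; ring

theorem integral_affine_mul_deriv {φ : ℝ → ℝ} (hφ : ContDiff ℝ ∞ φ) (hc : HasCompactSupport φ)
    (p q : ℝ) : ∫ x, (p * x + q) * deriv φ x = -p * ∫ x, φ x := by
  have hd : Continuous (deriv φ) := hφ.continuous_deriv (by simp)
  have hφi : Integrable φ := hφ.continuous.integrable_of_hasCompactSupport hc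
  have h1 : Integrable fun x => (p * x + q) * deriv φ x :=
    Continuous.integrable_of_hasCompactSupport (by fun_prop) hc.deriv.mul_left
  have h2 : Integrable fun x => (p * x + q) * φ x :=
    Continuous.integrable_of_hasCompactSupport (by have := hφ.continuous; fun_prop) hc.mul_left
  have hder : ∀ x, HasDerivAt (fun x => (p * x + q) * φ x) (p * φ x + (p * x + q) * deriv φ x) x := by
    intro x
    refine ((((hasDerivAt_id x).const_mul p).add_const q).mul
      (hφ.differentiable (by simp) x).hasDerivAt).congr_deriv ?_
    simp
  have h := integral_eq_zero_of_hasDerivAt_of_integrable hder ((hφi.const_mul p).add h1) h2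
  rw [integral_add (hφi.const_mul p) h1, integral_const_mul] at h
  linarith

theorem setIntegral_affine_mul_deriv {f φ : ℝ → ℝ} {p q : ℝ} {U : Set ℝ}
    (hf : ∀ᵐ x ∂(volume.restrict U), f x = p * x + q) (hφ : ContDiff ℝ ∞ φ)
    (hc : HasCompactSupport φ) (hs : tsupport φ ⊆ U) :
    ∫ x in U, f x * deriv φ x = -p * ∫ x in U, φ x := by
  have h1 : ∫ x in U, f x * deriv φ x = ∫ x in U, (p * x + q) * deriv φ x :=
    integral_congr_ae (by filter_upwards [hf] with x hx using by rw [hx])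
  rw [h1, setIntegral_eq_integral_of_forall_compl_eq_zero, setIntegral_eq_integral_of_forall_compl_eq_zero,
    integral_affine_mul_deriv hφ hc]
  · exact fun x hx => image_eq_zero_of_notMem_tsupport fun h => hx (hs h)
  · intro x hx
    have : deriv φ x = 0 := by
      by_contra h
      exact hx (hs (support_deriv_subset h))
    rw [this, mul_zero]

theorem exists_contDiff_eq_one_on_compact {K U : Set ℝ} (hK : IsCompact K) (hU : IsOpen U)
    (hKU : K ⊆ U) : ∃ φ : ℝ → ℝ, ContDiff ℝ ∞ φ ∧ HasCompactSupport φ ∧ tsupport φ ⊆ U ∧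
      (∀ x, φ x ∈ Icc (0 : ℝ) 1) ∧ ∀ x ∈ K, φ x = 1 := by
  obtain ⟨V, hV, hKV, hVU, hVc⟩ := exists_open_between_and_isCompact_closure hK hU hKU
  obtain ⟨φ, h1, h2, h3, h4⟩ := exists_contMDiff_support_eq_eq_one_iff (n := (⊤ : ℕ∞))
    (modelWithCornersSelf ℝ ℝ) hV hK.isClosed hKV
  have hts : tsupport φ = closure V := by rw [tsupport, h3]
  exact ⟨φ, h1.contDiff, by rw [HasCompactSupport, hts]; exact hVc, by rw [hts]; exact hVU,
    fun x => h2 (mem_range_self x), fun x hx => (h4 x).1 hx⟩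

theorem openVariation_affine {f : ℝ → ℝ} {p q : ℝ} {U : Set ℝ} (hU : IsOpen U)
    (hUf : volume U ≠ ⊤) (hf : ∀ᵐ x ∂(volume.restrict U), f x = p * x + q) :
    openVariation f U = ENNReal.ofReal |p| * volume U := by
  have hfin : IsFiniteMeasure (volume.restrict U) := ⟨by simpa using hUf.lt_top⟩
  apply le_antisymm
  · refine iSup_le fun φ => iSup_le fun hφ => iSup_le fun hc => iSup_le fun hs => iSup_le fun hb => ?_
    rw [setIntegral_affine_mul_deriv hf hφ hc hs, ← ENNReal.ofReal_toReal hUf,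
      ← ENNReal.ofReal_mul (abs_nonneg p)]
    apply ENNReal.ofReal_le_ofReal
    have h1 : ‖∫ x in U, φ x‖ ≤ 1 * (volume U).toReal :=
      norm_setIntegral_le_of_norm_le_const hUf.lt_top fun x _ => hb x
    rw [one_mul] at h1
    calc -p * ∫ x in U, φ x ≤ |-p * ∫ x in U, φ x| := le_abs_self _
      _ = |p| * ‖∫ x in U, φ x‖ := by rw [abs_mul, abs_neg, Real.norm_eq_abs]
      _ ≤ _ := mul_le_mul_of_nonneg_left h1 (abs_nonneg p)
  · rw [hU.measure_eq_iSup_isCompact, ENNReal.mul_iSup]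
    refine iSup_le fun K => ?_
    rw [ENNReal.mul_iSup]
    refine iSup_le fun hKU => ?_
    rw [ENNReal.mul_iSup]
    refine iSup_le fun hK => ?_
    obtain ⟨φ, hφ, hc, hs, h01, h1⟩ := exists_contDiff_eq_one_on_compact hK hU hKU
    -- The sign of `-p` turns the integral into `|p| ∫ φ`.
    obtain ⟨σ, hσ, hσp⟩ : ∃ σ : ℝ, |σ| ≤ 1 ∧ -p * σ = |p| := by
      rcases abs_cases p with h | h
      · exact ⟨-1, by norm_num, by rw [h.1]; ring⟩
      · exact ⟨1, by norm_num, by rw [h.1]; ring⟩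
    have hsub : tsupport (fun x => σ * φ x) ⊆ tsupport φ :=
      closure_mono (Function.support_mul_subset_right _ _)
    have hval : ENNReal.ofReal |p| * volume K ≤
        ENNReal.ofReal (∫ x in U, f x * deriv (fun x => σ * φ x) x) := by
      rw [setIntegral_affine_mul_deriv hf (contDiff_const.mul hφ) hc.mul_left (hsub.trans hs),
        integral_const_mul, ← mul_assoc, hσp, ENNReal.ofReal_mul (abs_nonneg p)]
      refine mul_le_mul_right ?_ _
      have hKm := hK.measurableSet
      have hKf : volume K ≠ ⊤ := hK.measure_lt_top.ne
      rw [← ENNReal.ofReal_toReal hKf]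
      apply ENNReal.ofReal_le_ofReal
      have hi : IntegrableOn φ U := (hφ.continuous.integrable_of_hasCompactSupport hc).integrableOn
      have e1 : ∫ x in K, φ x = (volume K).toReal := by
        rw [setIntegral_congr_fun hKm (g := fun _ => (1 : ℝ)) h1]
        simp [Measure.real]
      rw [← e1]
      exact setIntegral_mono_set hi (Eventually.of_forall fun x => (h01 x).1)
        (LE.le.eventuallyLE hKU)
    refine hval.trans ?_
    refine le_iSup_of_le (fun x => σ * φ x) <| le_iSup_of_le (contDiff_const.mul hφ) <|
      le_iSup_of_le hc.mul_left <| le_iSup_of_le (hsub.trans hs) <| le_iSup_of_le (fun x => ?_) le_rfl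
    rw [abs_mul, abs_of_nonneg (h01 x).1]
    exact mul_le_one₀ hσ (h01 x).1 (h01 x).2

theorem totalVariation_affine {f : ℝ → ℝ} {a b p q : ℝ}
    (hf : ∀ᵐ x ∂(volume.restrict (Ioo a b)), f x = p * x + q) {B : Set ℝ} (hB : B ⊆ Ioo a b) :
    totalVariation f a b B = ENNReal.ofReal |p| * volume B := by
  have hopen : ∀ U, IsOpen U → U ⊆ Ioo a b → openVariation f U = ENNReal.ofReal |p| * volume U :=
    fun U hU hUab => openVariation_affine hU
      ((measure_mono hUab).trans_lt measure_Ioo_lt_top).ne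
      (ae_restrict_of_ae_restrict_of_subset hUab hf)
  apply le_antisymm
  · rw [B.measure_eq_iInf_isOpen]
    by_cases hp : p = 0
    · refine (iInf_le_of_le (Ioo a b) <| iInf_le_of_le isOpen_Ioo <| iInf_le_of_le hB <|
        iInf_le_of_le Subset.rfl ?_)
      rw [hopen _ isOpen_Ioo Subset.rfl, hp]
      simp
    have hp0 : ENNReal.ofReal |p| ≠ 0 := by simpa using hp
    rw [ENNReal.mul_iInf_of_ne hp0 ENNReal.ofReal_ne_top]
    refine le_iInf fun U => ?_
    rw [ENNReal.mul_iInf_of_ne hp0 ENNReal.ofReal_ne_top]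
    refine le_iInf fun hBU => ?_
    rw [ENNReal.mul_iInf_of_ne hp0 ENNReal.ofReal_ne_top]
    refine le_iInf fun hU => ?_
    refine (iInf_le_of_le (U ∩ Ioo a b) <| iInf_le_of_le (hU.inter isOpen_Ioo) <|
      iInf_le_of_le (subset_inter hBU hB) <| iInf_le_of_le inter_subset_right ?_)
    rw [hopen _ (hU.inter isOpen_Ioo) inter_subset_right]
    exact mul_le_mul_right (measure_mono inter_subset_left) _
  · refine le_iInf fun U => le_iInf fun hU => le_iInf fun hBU => le_iInf fun hUab => ?_
    rw [hopen U hU hUab]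
    exact mul_le_mul_right (measure_mono hBU) _

/-- A measure on `(a, b)` giving each compactly contained interval a fixed multiple of its length is
that multiple of Lebesgue measure. -/
theorem measure_eq_smul_volume_of_Ioo {a b : ℝ} (hab : a < b) {μ : Measure (Ioo a b)} {k : ℝ≥0∞}
    (hk : k ≠ ⊤) (hμ : ∀ c d : ℝ, a < c → c < d → d < b →
      μ (Subtype.val ⁻¹' Ioo c d) = k * volume (Ioo c d)) {B : Set (Ioo a b)}
    (hB : MeasurableSet B) : μ B = k * volume (Subtype.val '' B : Set ℝ) := by
  let ν : Measure ℝ := μ.map Subtype.val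
  have hν : ∀ c d : ℝ, a < c → d < b → ν (Ioo c d) = k * volume (Ioo c d) := by
    intro c d hc hd
    rcases lt_or_ge c d with h | h
    · rw [Measure.map_apply measurable_subtype_coe measurableSet_Ioo, hμ c d hc h hd]
    · rw [Ioo_eq_empty (not_lt.2 h)]; simp
  obtain ⟨m, hm⟩ := exists_between hab
  obtain ⟨u, -, hu_mem, hu_lim⟩ := exists_seq_strictAnti_tendsto' hm.1
  obtain ⟨v, -, hv_mem, hv_lim⟩ := exists_seq_strictMono_tendsto' hm.2
  have hU : Ioo a b = ⋃ n, Ioo (u n) (v n) := by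
    ext x
    rw [mem_iUnion]
    refine ⟨fun hx => ?_, fun ⟨n, hn⟩ => ⟨(hu_mem n).1.trans hn.1, hn.2.trans (hv_mem n).2⟩⟩
    obtain ⟨n, h1, h2⟩ := ((hu_lim.eventually (gt_mem_nhds hx.1)).and
      (hv_lim.eventually (lt_mem_nhds hx.2))).exists
    exact ⟨n, h1, h2⟩
  have hres : ν.restrict (Ioo a b) = (k • volume).restrict (Ioo a b) := by
    rw [hU, Measure.restrict_iUnion_congr]
    intro n
    have hfin : IsFiniteMeasure (ν.restrict (Ioo (u n) (v n))) := ⟨by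
      rw [Measure.restrict_apply_univ, hν _ _ (hu_mem n).1 (hv_mem n).2, Real.volume_Ioo]
      exact ENNReal.mul_lt_top hk.lt_top ENNReal.ofReal_lt_top⟩
    refine Real.measure_ext_Ioo_rat fun r s => ?_
    rw [Measure.restrict_apply measurableSet_Ioo, Measure.restrict_apply measurableSet_Ioo,
      Ioo_inter_Ioo, Measure.smul_apply, smul_eq_mul]
    exact hν _ _ (lt_max_of_lt_right (hu_mem n).1) (min_lt_of_right_lt (hv_mem n).2)
  have hBm : MeasurableSet (Subtype.val '' B : Set ℝ) := measurableSet_Ioo.subtype_image hB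
  have hBs : (Subtype.val '' B : Set ℝ) ⊆ Ioo a b := by
    rintro _ ⟨x, -, rfl⟩; exact x.2
  have h := congrArg (fun ρ : Measure ℝ => ρ (Subtype.val '' B)) hres
  simp only [Measure.restrict_apply hBm, inter_eq_left.2 hBs, Measure.smul_apply, smul_eq_mul] at h
  rwa [Measure.map_apply measurable_subtype_coe hBm,
    preimage_image_eq _ Subtype.val_injective] at h

theorem theorem2 (a b : ℝ) (hab : a < b) (f : ℝ → ℝ)
    (hf : LocallyIntegrableOn f (Ioo a b) volume)
    (μ : Measure (Ioo a b))
    (hμ : ∀ c d : ℝ, a < c → c < d → d < b →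
      μ (Subtype.val ⁻¹' Ioo c d) = ENNReal.ofReal (osc f c d)) :
    (∀ B : Set (Ioo a b), MeasurableSet B →
      μ B = (1 / 4 : ℝ≥0∞) * totalVariation f a b (Subtype.val '' B)) ∧
    ∃ p q : ℝ, ∀ᵐ x ∂(volume.restrict (Ioo a b)), f x = p * x + q := by
  obtain ⟨p, q, h⟩ := exists_ae_eq_affine hab hf hμ
  refine ⟨fun B hB => ?_, p, q, h⟩
  have hBs : (Subtype.val '' B : Set ℝ) ⊆ Ioo a b := by
    rintro _ ⟨x, -, rfl⟩; exact x.2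
  rw [totalVariation_affine h hBs, ← mul_assoc]
  have hk : (1 / 4 : ℝ≥0∞) * ENNReal.ofReal |p| = ENNReal.ofReal (|p| / 4) := by
    rw [ENNReal.ofReal_div_of_pos (by norm_num), one_div, mul_comm, ← div_eq_mul_inv]
    norm_num
  rw [hk]
  refine measure_eq_smul_volume_of_Ioo hab ENNReal.ofReal_ne_top (fun c d hc hcd hd => ?_) hB
  rw [hμ c d hc hcd hd, Real.volume_Ioo, ← ENNReal.ofReal_mul (by positivity), ← osc_affine p q hcd]
  congr 1
  exact osc_congr_ae (ae_restrict_of_ae_restrict_of_subset (Ioo_subset_Ioo hc.le hd.le) h)
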